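/- Let $Y$ be a compact connected (Hausdorff) complex manifold and let $\pi:E\to Y$ be a holomorphic vector bundle of finite rank. Suppose that $Y$ admits a local dominating holomorphic spray $(E,\pi,s)$: there are an open neighbourhood $U\subset E$ of the zero section and a holomorphic map $s:U\to Y$ such that, for every $y\in Y$, $s(0_y)=y$ and the differential $ds_{0_y}$ at the origin $0_y$ of the fibre $E_y=\pi^{-1}(y)$ maps $E_y$ (regarded as the vertical tangent space $\ker d\pi_{0_y}$ of $E$ at $0_y$) onto $T_yY$. Suppose also that $E$ is generated by global holomorphic sections: for every $y\in Y$ the values at $y$ of the global holomorphic sections $Y\to E$ span $E_y$. Then $Y$ is a complex homogeneous manifold: there is a complex Lie group $G$ (finite-dimensional, Hausdorff and second countable) with a holomorphic action $G\times Y\to Y$ that is transitive. -/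

import Mathlib

open scoped Manifold ContDiff Bundle

universe u

/-- The vertical tangent space at the point `0_y` of the zero section of `π : E → Y`: the kernel of
the differential of the bundle projection, i.e. the tangent space of the fibre `E_y` at its
origin. -/
noncomputable def verticalTangentZero
    {V : Type*} [NormedAddCommGroup V] [NormedSpace ℂ V]
    {Y : Type*} [TopologicalSpace Y] [ChartedSpace V Y]
    (F : Type*) [NormedAddCommGroup F] [NormedSpace ℂ F]
    (E : Y → Type*) [TopologicalSpace (Bundle.TotalSpace F E)] [∀ y, TopologicalSpace (E y)]
    [∀ y, AddCommGroup (E y)] [FiberBundle F E] (y : Y) :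
    Submodule ℂ (TangentSpace (𝓘(ℂ, V).prod 𝓘(ℂ, F)) (Bundle.zeroSection F E y)) :=
  (mfderiv (𝓘(ℂ, V).prod 𝓘(ℂ, F)) 𝓘(ℂ, V) (Bundle.TotalSpace.proj : Bundle.TotalSpace F E → Y)
    (Bundle.zeroSection F E y)).ker

/-- `s` is a local dominating holomorphic spray on `Y`, defined on the open neighbourhood `U` of the
zero section of the vector bundle `E → Y` (values of `s` outside `U` are irrelevant). -/
structure IsLocalDominatingSpray
    {V : Type*} [NormedAddCommGroup V] [NormedSpace ℂ V]
    {Y : Type*} [TopologicalSpace Y] [ChartedSpace V Y]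
    (F : Type*) [NormedAddCommGroup F] [NormedSpace ℂ F]
    (E : Y → Type*) [TopologicalSpace (Bundle.TotalSpace F E)] [∀ y, TopologicalSpace (E y)]
    [∀ y, AddCommGroup (E y)] [FiberBundle F E]
    (U : Set (Bundle.TotalSpace F E)) (s : Bundle.TotalSpace F E → Y) : Prop where
  isOpen : IsOpen U
  zeroSection_mem : ∀ y : Y, Bundle.zeroSection F E y ∈ U
  holomorphicOn : ContMDiffOn (𝓘(ℂ, V).prod 𝓘(ℂ, F)) 𝓘(ℂ, V) ω s U
  apply_zeroSection : ∀ y : Y, s (Bundle.zeroSection F E y) = y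
  /-- the differential `ds` at `0_y` maps the (tangent space of the) fibre `E_y` onto `T_y Y` -/
  dominating : ∀ y : Y,
    (verticalTangentZero (V := V) F E y).map
      (mfderiv (𝓘(ℂ, V).prod 𝓘(ℂ, F)) 𝓘(ℂ, V) s (Bundle.zeroSection F E y)).toLinearMap = ⊤

/-- The holomorphic vector bundle `E → Y` is generated by global holomorphic sections: for each `y`
the values at `y` of the global holomorphic sections span the fibre `E_y`. -/
def IsGloballyGenerated
    (V : Type*) [NormedAddCommGroup V] [NormedSpace ℂ V]
    {Y : Type*} [TopologicalSpace Y] [ChartedSpace V Y]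
    (F : Type*) [NormedAddCommGroup F] [NormedSpace ℂ F]
    (E : Y → Type*) [TopologicalSpace (Bundle.TotalSpace F E)] [∀ y, TopologicalSpace (E y)]
    [∀ y, AddCommGroup (E y)] [∀ y, Module ℂ (E y)] [FiberBundle F E] : Prop :=
  ∀ y : Y, Submodule.span ℂ (Set.range fun σ : Cₛ^ω⟮𝓘(ℂ, V); F, E⟯ => σ y) = ⊤

/-- `Y` is complex homogeneous: some (finite-dimensional, Hausdorff, second countable) complex Lie
group acts holomorphically and transitively on `Y`. Second countability is part of the notion of a
Lie group; without it every group would be a `0`-dimensional Lie group. -/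
def IsComplexHomogeneous
    (V : Type*) [NormedAddCommGroup V] [NormedSpace ℂ V]
    (Y : Type u) [TopologicalSpace Y] [ChartedSpace V Y] : Prop :=
  ∃ (m : ℕ) (G : Type u) (_ : TopologicalSpace G) (_ : ChartedSpace (EuclideanSpace ℂ (Fin m)) G)
    (_ : Group G) (_ : MulAction G Y),
    T2Space G ∧ SecondCountableTopology G ∧
    LieGroup 𝓘(ℂ, EuclideanSpace ℂ (Fin m)) ω G ∧
    ContMDiffSMul 𝓘(ℂ, EuclideanSpace ℂ (Fin m)) 𝓘(ℂ, V) ω G Y ∧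
    MulAction.IsPretransitive G Y

/-! A global section `σ` turns the spray into the self-maps `y ↦ s (z • σ y)` of `Y`, which are the
identity at `z = 0`. Compactness makes them automorphisms for small `z`
(`exists_holAt_of_near_identity`), and their velocity at `y` is the image of `σ y` under the
differential of `s` at `0_y`. Domination and global generation therefore say that velocities of
families of automorphisms fill every tangent space (`IsLocalDominatingSpray.exists_autVF`). It
remains to find a Lie group of automorphisms with all these velocities.

Such a group is built without integrating vector fields. Let `autVF` be the space of velocities
realised by holomorphic families of automorphisms. It consists of holomorphic vector fields, and on
a compact manifold finitely many values determine such a field (`exists_finset_determining_holVF`,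
by compactness and the Schwarz lemma), so `autVF` is finite-dimensional. Multiplying one-parameter
families that realise a basis gives a family `φ` whose velocities at `0` are exactly `autVF`.

The core is `exists_reparametrization`: near `0`, every holomorphic family meeting `φ` factors
holomorphically through `φ`. As `φ` already has as many parameters as there are velocities, a
dimension count forces a family to be constant wherever its finitely many coordinates are constant.
Translates, products and inverses of `φ` are themselves holomorphic families, so `φ` is a chart at
the identity making the subgroup it generates a Lie group (`IsLocalLieChart.exists_lieGroup`). Its
orbits are open since velocities span, and connectedness of `Y` leaves a single orbit. -/

open scoped Manifold ContDiff Bundle Topology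

/-! ### Holomorphic families of automorphisms -/

section Families

variable {V : Type*} [NormedAddCommGroup V] [NormedSpace ℂ V]
  {Y : Type u} [TopologicalSpace Y] [ChartedSpace V Y]
  {W : Type*} [NormedAddCommGroup W] [NormedSpace ℂ W]
  {W' : Type*} [NormedAddCommGroup W'] [NormedSpace ℂ W']

variable (V) in
/-- A family `Ψ` of permutations of `Y` is a holomorphic family of automorphisms near `w`. -/
def HolAt (Ψ : W → Equiv.Perm Y) (w : W) : Prop :=
  ∀ y : Y, ContMDiffAt (𝓘(ℂ, W).prod 𝓘(ℂ, V)) 𝓘(ℂ, V) ω (fun q : W × Y => Ψ q.1 q.2) (w, y) ∧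
    ContMDiffAt (𝓘(ℂ, W).prod 𝓘(ℂ, V)) 𝓘(ℂ, V) ω (fun q : W × Y => (Ψ q.1)⁻¹ q.2) (w, y)

namespace HolAt

lemma comp_param {Ψ : W → Equiv.Perm Y} {τ : W' → W} {w : W'} (hτ : ContDiffAt ℂ ω τ w)
    (hΨ : HolAt V Ψ (τ w)) : HolAt V (fun w' => Ψ (τ w')) w := by
  intro y
  have h : ContMDiffAt (𝓘(ℂ, W').prod 𝓘(ℂ, V)) (𝓘(ℂ, W).prod 𝓘(ℂ, V)) ω
      (fun q : W' × Y => (τ q.1, q.2)) (w, y) :=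
    (hτ.contMDiffAt.comp (w, y) contMDiffAt_fst).prodMk contMDiffAt_snd
  exact ⟨ContMDiffAt.comp (w, y) (hΨ y).1 h, ContMDiffAt.comp (w, y) (hΨ y).2 h⟩

lemma const {Ψ : W → Equiv.Perm Y} {w : W} (hΨ : HolAt V Ψ w) (w' : W') :
    HolAt V (fun _ : W' => Ψ w) w' :=
  comp_param (τ := fun _ => w) contDiffAt_const hΨ

lemma one (w : W) : HolAt V (fun _ : W => (1 : Equiv.Perm Y)) w := fun _ =>
  ⟨by simpa using contMDiffAt_snd, by simpa using contMDiffAt_snd⟩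

lemma inv {Ψ : W → Equiv.Perm Y} {w : W} (hΨ : HolAt V Ψ w) :
    HolAt V (fun w => (Ψ w)⁻¹) w := fun y => ⟨(hΨ y).2, by simpa using (hΨ y).1⟩

lemma mul {Ψ Φ : W → Equiv.Perm Y} {w : W} (hΨ : HolAt V Ψ w) (hΦ : HolAt V Φ w) :
    HolAt V (fun w => Ψ w * Φ w) w := by
  intro y
  constructor
  · exact ContMDiffAt.comp (w, y) (g := fun q : W × Y => Ψ q.1 q.2)
      (f := fun q : W × Y => (q.1, Φ q.1 q.2)) (hΨ _).1 (contMDiffAt_fst.prodMk (hΦ y).1)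
  · simp only [mul_inv_rev]
    exact ContMDiffAt.comp (w, y) (g := fun q : W × Y => (Φ q.1)⁻¹ q.2)
      (f := fun q : W × Y => (q.1, (Ψ q.1)⁻¹ q.2)) (hΦ _).2 (contMDiffAt_fst.prodMk (hΨ y).2)

lemma congr {Ψ Φ : W → Equiv.Perm Y} {w : W} (hΨ : HolAt V Ψ w) (h : ∀ᶠ w' in 𝓝 w, Φ w' = Ψ w') :
    HolAt V Φ w := by
  intro y
  have h' : ∀ᶠ q : W × Y in 𝓝 (w, y), Φ q.1 = Ψ q.1 := by
    rw [nhds_prod_eq]; exact h.prod_inl _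
  exact ⟨(hΨ y).1.congr_of_eventuallyEq (h'.mono fun q hq => by simp [hq]),
    (hΨ y).2.congr_of_eventuallyEq (h'.mono fun q hq => by simp [hq])⟩

/-- Analyticity at a point persists nearby; compactness of `Y` gives one neighbourhood of `w` that
serves all `y`. -/
lemma eventually [CompleteSpace W] [CompleteSpace V] [IsManifold 𝓘(ℂ, V) ω Y] [CompactSpace Y]
    {Ψ : W → Equiv.Perm Y} {w : W} (hΨ : HolAt V Ψ w) : ∀ᶠ w' in 𝓝 w, HolAt V Ψ w' := by
  have key : ∀ y ∈ (Set.univ : Set Y), ∀ᶠ q : W × Y in 𝓝 (w, y),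
      ContMDiffAt (𝓘(ℂ, W).prod 𝓘(ℂ, V)) 𝓘(ℂ, V) ω (fun q : W × Y => Ψ q.1 q.2) q ∧
      ContMDiffAt (𝓘(ℂ, W).prod 𝓘(ℂ, V)) 𝓘(ℂ, V) ω (fun q : W × Y => (Ψ q.1)⁻¹ q.2) q := by
    intro y _
    exact ((contMDiffAt_iff_contMDiffAt_nhds (by simp)).1 (hΨ y).1).and
      ((contMDiffAt_iff_contMDiffAt_nhds (by simp)).1 (hΨ y).2)
  filter_upwards [isCompact_univ.eventually_forall_of_forall_eventually
    (P := fun w' y =>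
      ContMDiffAt (𝓘(ℂ, W).prod 𝓘(ℂ, V)) 𝓘(ℂ, V) ω (fun q : W × Y => Ψ q.1 q.2) (w', y) ∧
      ContMDiffAt (𝓘(ℂ, W).prod 𝓘(ℂ, V)) 𝓘(ℂ, V) ω (fun q : W × Y => (Ψ q.1)⁻¹ q.2) (w', y)) key] with w' h y
  exact h y trivial

lemma apply {Ψ : W → Equiv.Perm Y} {w : W} (hΨ : HolAt V Ψ w) (y : Y) :
    ContMDiffAt 𝓘(ℂ, W) 𝓘(ℂ, V) ω (fun b => Ψ b y) w :=
  ContMDiffAt.comp w (g := fun q : W × Y => Ψ q.1 q.2) (f := fun b : W => (b, y)) (hΨ y).1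
    (contMDiffAt_id.prodMk contMDiffAt_const)

lemma apply' {Ψ : W → Equiv.Perm Y} {w : W} (hΨ : HolAt V Ψ w) (y : Y) :
    ContMDiffAt 𝓘(ℂ, V) 𝓘(ℂ, V) ω (Ψ w) y :=
  ContMDiffAt.comp y (g := fun q : W × Y => Ψ q.1 q.2) (f := fun y : Y => (w, y)) (hΨ y).1
    (contMDiffAt_const.prodMk contMDiffAt_id)

lemma list_prod {l : List (W → Equiv.Perm Y)} {w : W} (h : ∀ Ψ ∈ l, HolAt V Ψ w) :
    HolAt V (fun b => (l.map fun Ψ => Ψ b).prod) w := by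
  induction l with
  | nil => simpa using one w
  | cons Ψ l ih =>
    simp only [List.map_cons, List.prod_cons]
    exact (h Ψ (by simp)).mul (ih fun Φ hΦ => h Φ (by simp [hΦ]))

end HolAt

/-! ### Derivatives of maps into `Y`, read in preferred charts -/

section Charts

variable [IsManifold 𝓘(ℂ, V) ω Y]

lemma contDiffAt_chart_comp {f : W → Y} {a : W} {y : Y} (hf : ContMDiffAt 𝓘(ℂ, W) 𝓘(ℂ, V) ω f a)
    (hy : f a ∈ (chartAt V y).source) : ContDiffAt ℂ ω (fun b => chartAt V y (f b)) a := by
  have h1 : ContMDiffAt 𝓘(ℂ, V) 𝓘(ℂ, V) ω (chartAt V y) (f a) :=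
    (contMDiffOn_chart (I := 𝓘(ℂ, V)) (n := ω)).contMDiffAt ((chartAt V y).open_source.mem_nhds hy)
  exact (h1.comp a hf).contDiffAt

lemma hasFDerivAt_chart_change {y y' z : Y} (hy : z ∈ (chartAt V y).source)
    (hy' : z ∈ (chartAt V y').source) :
    HasFDerivAt (fun x => chartAt V y' ((chartAt V y).symm x))
      (tangentCoordChange 𝓘(ℂ, V) y y' z) (chartAt V y z) := by
  have : IsManifold 𝓘(ℂ, V) 1 Y := IsManifold.of_le (n := ω) le_top
  have := hasFDerivWithinAt_tangentCoordChange (I := 𝓘(ℂ, V)) (x := y) (y := y') (z := z)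
    (by simp [hy, hy'])
  simpa [hasFDerivWithinAt_univ, Function.comp_def] using this

lemma fderiv_chart_comp {f : W → Y} {a : W} {y : Y} (hf : ContMDiffAt 𝓘(ℂ, W) 𝓘(ℂ, V) ω f a)
    (hy : f a ∈ (chartAt V y).source) :
    fderiv ℂ (fun b => chartAt V y (f b)) a =
      (tangentCoordChange 𝓘(ℂ, V) (f a) y (f a)).comp
        (fderiv ℂ (fun b => chartAt V (f a) (f b)) a) := by
  have h1 := hasFDerivAt_chart_change (mem_chart_source V (f a)) hy
  have h2 := (contDiffAt_chart_comp hf (mem_chart_source V (f a))).differentiableAt (by simp)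
  have h3 := h1.comp a h2.hasFDerivAt
  refine (h3.congr_of_eventuallyEq ?_).fderiv
  filter_upwards [hf.continuousAt.preimage_mem_nhds
    ((chartAt V (f a)).open_source.mem_nhds (mem_chart_source V (f a)))] with b hb
  simp only [Function.comp_def]
  rw [(chartAt V (f a)).left_inv hb]

lemma tangentCoordChange_eq_zero_iff {y z : Y} (hz : z ∈ (chartAt V y).source) {v : V} :
    tangentCoordChange 𝓘(ℂ, V) z y z v = 0 ↔ v = 0 := by
  have : IsManifold 𝓘(ℂ, V) 1 Y := IsManifold.of_le (n := ω) le_top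
  refine ⟨fun h => ?_, fun h => by rw [h, map_zero]⟩
  have h1 := tangentCoordChange_comp (I := 𝓘(ℂ, V)) (w := z) (x := y) (y := z) (z := z) (v := v)
    (by simp [hz])
  rw [h, map_zero, tangentCoordChange_self (by simp)] at h1
  exact h1.symm

/-- Vanishing of the derivative does not depend on the chart, so `γ` is constant on a small ball
read in one fixed chart; preconnectedness of `B` does the rest. -/
lemma eq_of_fderiv_chart_eq_zero {γ : W → Y} {B : Set W} (hB : IsOpen B) (hc : IsPreconnected B)
    (hγ : ∀ b ∈ B, ContMDiffAt 𝓘(ℂ, W) 𝓘(ℂ, V) ω γ b)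
    (h0 : ∀ b ∈ B, fderiv ℂ (fun b' => chartAt V (γ b) (γ b')) b = 0)
    {b b' : W} (hb : b ∈ B) (hb' : b' ∈ B) : γ b = γ b' := by
  have loc : ∀ b ∈ B, ∀ᶠ b' in 𝓝 b, γ b' = γ b := by
    intro b hb
    have hsrc := (hγ b hb).continuousAt.preimage_mem_nhds
      ((chartAt V (γ b)).open_source.mem_nhds (mem_chart_source V (γ b)))
    obtain ⟨r, hr, hsub⟩ := Metric.mem_nhds_iff.1 (Filter.inter_mem hsrc (hB.mem_nhds hb))
    filter_upwards [Metric.ball_mem_nhds b hr] with b' hb'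
    have hd : ∀ x ∈ Metric.ball b r, ContDiffAt ℂ ω (fun b' => chartAt V (γ b) (γ b')) x :=
      fun x hx => contDiffAt_chart_comp (hγ x (hsub hx).2) (hsub hx).1
    have := Metric.isOpen_ball.is_const_of_fderiv_eq_zero (𝕜 := ℂ)
      (convex_ball b r).isPreconnected
      (fun x hx => ((hd x hx).differentiableAt (by simp)).differentiableWithinAt)
      (fun x hx => by
        rw [fderiv_chart_comp (hγ x (hsub hx).2) (hsub hx).1, h0 x (hsub hx).2]; simp)
      hb' (Metric.mem_ball_self hr)
    exact (chartAt V (γ b)).injOn (hsub hb').1 (mem_chart_source V (γ b)) this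
  have : PreconnectedSpace B := Subtype.preconnectedSpace hc
  have hl : IsLocallyConstant (fun x : B => γ x) := by
    rw [IsLocallyConstant.iff_eventually_eq]
    intro x
    exact continuous_subtype_val.continuousAt.eventually (loc x x.2)
  exact hl.apply_eq_of_preconnectedSpace ⟨b, hb⟩ ⟨b', hb'⟩

end Charts

/-! ### Velocities of families and their algebra -/

/-- The right logarithmic derivative at `a` of a family of permutations, as a vector field on `Y`
(read at each point in the preferred chart there). -/
noncomputable def vel (Λ : W → Equiv.Perm Y) (a : W) : W →ₗ[ℂ] (Y → V) where
  toFun ξ y := fderiv ℂ (fun b => chartAt V y (Λ b ((Λ a)⁻¹ y))) a ξ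
  map_add' ξ η := by ext y; simp
  map_smul' c ξ := by ext y; simp

lemma vel_apply (Λ : W → Equiv.Perm Y) (a ξ : W) (y : Y) :
    vel Λ a ξ y = fderiv ℂ (fun b => chartAt V y (Λ b ((Λ a)⁻¹ y))) a ξ := rfl

lemma vel_apply_image (Λ : W → Equiv.Perm Y) (a ξ : W) (y : Y) :
    vel Λ a ξ (Λ a y) = fderiv ℂ (fun b => chartAt V (Λ a y) (Λ b y)) a ξ := by
  simp [vel_apply]

lemma vel_mul_const (Λ : W → Equiv.Perm Y) (g : Equiv.Perm Y) (a : W) :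
    vel (V := V) (fun b => Λ b * g) a = vel Λ a := by
  ext ξ y
  simp [vel_apply]

section

variable [IsManifold 𝓘(ℂ, V) ω Y]

lemma fderiv_chart_eq_vel {Λ : W → Equiv.Perm Y} {a : W} (h : HolAt V Λ a) {y z : Y}
    (hz : Λ a z ∈ (chartAt V y).source) (ξ : W) :
    fderiv ℂ (fun b => chartAt V y (Λ b z)) a ξ =
      tangentCoordChange 𝓘(ℂ, V) (Λ a z) y (Λ a z) (vel Λ a ξ (Λ a z)) := by
  rw [fderiv_chart_comp (h.apply z) hz, vel_apply_image]; rfl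

lemma vel_comp_param {Λ : W → Equiv.Perm Y} {τ : W' → W} {a : W'} (h : HolAt V Λ (τ a))
    (hτ : DifferentiableAt ℂ τ a) (ξ : W') :
    vel (V := V) (fun b => Λ (τ b)) a ξ = vel Λ (τ a) (fderiv ℂ τ a ξ) := by
  ext y
  rw [vel_apply, vel_apply]
  have h1 : DifferentiableAt ℂ (fun b => chartAt V y (Λ b ((Λ (τ a))⁻¹ y))) (τ a) :=
    (contDiffAt_chart_comp (h.apply _) (by simp)).differentiableAt (by simp)
  have := fderiv_comp a h1 hτ
  simp only [Function.comp_def] at this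
  rw [this]; rfl

/-- In a chart at `y` the product is `F (b, Ψ b y)`, with `F` the expression of `Φ`. The chain rule
gives two terms, and the partial derivative of `F` in the space variable is the identity because `Φ
a = 1`. -/
lemma vel_mul_of_eq_one {Φ Ψ : W → Equiv.Perm Y} {a : W} (hΦ : HolAt V Φ a) (hΨ : HolAt V Ψ a)
    (hΦ1 : Φ a = 1) (hΨ1 : Ψ a = 1) :
    vel (V := V) (fun b => Φ b * Ψ b) a = vel Φ a + vel Ψ a := by
  ext ξ y
  simp only [vel_apply, LinearMap.add_apply, Pi.add_apply, hΦ1, hΨ1, mul_one, inv_one,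
    Equiv.Perm.coe_one, id_eq, Equiv.Perm.coe_mul, Function.comp_apply]
  set e := chartAt V y
  have hy : y ∈ e.source := mem_chart_source V y
  have hsymm : ContMDiffAt 𝓘(ℂ, V) 𝓘(ℂ, V) ω e.symm (e y) :=
    (contMDiffOn_chart_symm (I := 𝓘(ℂ, V)) (n := ω)).contMDiffAt
      (e.open_target.mem_nhds (e.map_source hy))
  have hF : ContDiffAt ℂ ω (fun q : W × V => e (Φ q.1 (e.symm q.2))) (a, e y) := by
    have h1 : ContMDiffAt 𝓘(ℂ, W × V) (𝓘(ℂ, W).prod 𝓘(ℂ, V)) ω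
        (fun q : W × V => (q.1, e.symm q.2)) (a, e y) := by
      rw [modelWithCornersSelf_prod, ← chartedSpaceSelf_prod]
      exact contMDiffAt_fst.prodMk (hsymm.comp (a, e y) contMDiffAt_snd)
    have h2 : ContMDiffAt 𝓘(ℂ, W × V) 𝓘(ℂ, V) ω
        (fun q : W × V => Φ q.1 (e.symm q.2)) (a, e y) :=
      ContMDiffAt.comp (a, e y) (g := fun q : W × Y => Φ q.1 q.2)
        (f := fun q : W × V => (q.1, e.symm q.2)) (hΦ _).1 h1
    exact contDiffAt_chart_comp h2 (by simp [hΦ1, e.left_inv hy, hy, e])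
  have hFd := (hF.differentiableAt (by simp)).hasFDerivAt
  have hΨd : HasFDerivAt (fun b => e (Ψ b y)) (fderiv ℂ (fun b => e (Ψ b y)) a) a :=
    ((contDiffAt_chart_comp (hΨ.apply y) (by simp [hΨ1])).differentiableAt (by simp)).hasFDerivAt
  have hΦd : fderiv ℂ (fun b => e (Φ b y)) a =
      (fderiv ℂ (fun q : W × V => e (Φ q.1 (e.symm q.2))) (a, e y)).comp
        ((ContinuousLinearMap.id ℂ W).prod 0) := by
    have := HasFDerivAt.comp (f := fun b : W => (b, e y)) a hFd
      ((hasFDerivAt_id a).prodMk (hasFDerivAt_const (e y) a))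
    simpa only [Function.comp_def, id_eq, e.left_inv hy] using this.fderiv
  have hsnd : (fderiv ℂ (fun q : W × V => e (Φ q.1 (e.symm q.2))) (a, e y)).comp
      ((0 : V →L[ℂ] W).prod (ContinuousLinearMap.id ℂ V)) = ContinuousLinearMap.id ℂ V := by
    have := hFd.comp (e y) ((hasFDerivAt_const a (e y)).prodMk (hasFDerivAt_id (e y)))
    refine (this.congr_of_eventuallyEq (f₁ := fun x => x) ?_).unique (hasFDerivAt_id _)
    filter_upwards [e.open_target.mem_nhds (e.map_source hy)] with x hx
    simp [hΦ1, e.right_inv hx]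
  have hFd' : HasFDerivAt (fun q : W × V => e (Φ q.1 (e.symm q.2)))
      (fderiv ℂ (fun q : W × V => e (Φ q.1 (e.symm q.2))) (a, e y)) (a, e (Ψ a y)) := by
    simpa [hΨ1] using hFd
  have hcomp := hFd'.comp a ((hasFDerivAt_id a).prodMk hΨd)
  have hcongr : (fun b => e (Φ b (Ψ b y))) =ᶠ[𝓝 a]
      ((fun q : W × V => e (Φ q.1 (e.symm q.2))) ∘ fun b => (id b, e (Ψ b y))) := by
    have hc : ContinuousAt (fun b => Ψ b y) a := (hΨ.apply y).continuousAt
    filter_upwards [hc.preimage_mem_nhds (e.open_source.mem_nhds (by simpa [hΨ1] using hy))]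
      with b hb
    simp only [Function.comp_apply, id_eq]
    rw [e.left_inv hb]
  rw [(hcomp.congr_of_eventuallyEq hcongr).fderiv, hΦd]
  -- The derivative of `F` is split along `(ξ, η) = (ξ, 0) + (0, η)`, and `hsnd` evaluates the
  -- second term to `η`.
  have h2 := congrArg (fun L : V →L[ℂ] V => L (fderiv ℂ (fun b => e (Ψ b y)) a ξ)) hsnd
  simp only [ContinuousLinearMap.comp_apply, ContinuousLinearMap.prod_apply,
    ContinuousLinearMap.id_apply, zero_apply] at h2 ⊢
  conv_rhs => rw [← h2, ← map_add]
  simp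

lemma vel_list_prod {l : List (W → Equiv.Perm Y)} {a : W} (h : ∀ Ψ ∈ l, HolAt V Ψ a ∧ Ψ a = 1) :
    vel (V := V) (fun b => (l.map fun Ψ => Ψ b).prod) a = (l.map fun Ψ => vel Ψ a).sum := by
  induction l with
  | nil => ext ξ y; simp [vel_apply]
  | cons Ψ l ih =>
    have hl : ∀ Φ ∈ l, HolAt V Φ a ∧ Φ a = 1 := fun Φ hΦ => h Φ (by simp [hΦ])
    simp only [List.map_cons, List.prod_cons, List.sum_cons]
    rw [vel_mul_of_eq_one (h Ψ (by simp)).1 (HolAt.list_prod fun Φ hΦ => (hl Φ hΦ).1)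
      (h Ψ (by simp)).2 (List.prod_eq_one (by simpa using fun Φ hΦ => (hl Φ hΦ).2)), ih hl]

end

end Families

/-! ### Holomorphic vector fields on a compact manifold -/

section HolomorphicVectorFields

variable {V : Type*} [NormedAddCommGroup V] [NormedSpace ℂ V]
  {Y : Type u} [TopologicalSpace Y] [ChartedSpace V Y] [IsManifold 𝓘(ℂ, V) ω Y]
  {W : Type*} [NormedAddCommGroup W] [NormedSpace ℂ W]

/-- The coordinate expression of a vector field in the preferred chart at `y`. -/
noncomputable def vfRep (y : Y) : (Y → V) →ₗ[ℂ] (V → V) where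
  toFun v x := tangentCoordChange 𝓘(ℂ, V) ((chartAt V y).symm x) y ((chartAt V y).symm x)
    (v ((chartAt V y).symm x))
  map_add' v w := by ext x; simp
  map_smul' c v := by ext x; simp

lemma vfRep_apply (y : Y) (v : Y → V) (x : V) : vfRep y v x =
    tangentCoordChange 𝓘(ℂ, V) ((chartAt V y).symm x) y ((chartAt V y).symm x)
      (v ((chartAt V y).symm x)) := rfl

lemma vfRep_eq_zero_iff {y : Y} {v : Y → V} {x : V} (hx : x ∈ (chartAt V y).target) :
    vfRep y v x = 0 ↔ v ((chartAt V y).symm x) = 0 :=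
  tangentCoordChange_eq_zero_iff ((chartAt V y).map_target hx)

lemma vfRep_change {i j : Y} {v : Y → V} {x : V} (hx : x ∈ (chartAt V i).target)
    (hj : (chartAt V i).symm x ∈ (chartAt V j).source) :
    vfRep i v x = tangentCoordChange 𝓘(ℂ, V) j i ((chartAt V i).symm x)
      (vfRep j v (chartAt V j ((chartAt V i).symm x))) := by
  have : IsManifold 𝓘(ℂ, V) 1 Y := IsManifold.of_le (n := ω) le_top
  rw [vfRep_apply, vfRep_apply, (chartAt V j).left_inv hj]
  exact (tangentCoordChange_comp (by simp [hj, (chartAt V i).map_target hx])).symm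

variable (V Y) in
/-- The space of holomorphic vector fields on `Y`. -/
def holVF : Submodule ℂ (Y → V) where
  carrier := {v | ∀ y : Y, DifferentiableOn ℂ (vfRep y v) (chartAt V y).target}
  add_mem' {v w} hv hw y := by rw [map_add]; exact (hv y).add (hw y)
  zero_mem' y := by rw [map_zero]; exact differentiableOn_const 0
  smul_mem' c v hv y := by rw [map_smul]; exact (hv y).const_smul c

/-- In a chart the velocity is a partial derivative, in the parameter, of a map analytic jointly in
parameter and point; it is therefore holomorphic in the point. -/
lemma vel_mem_holVF [CompleteSpace V] {Λ : W → Equiv.Perm Y} {a : W} (h : HolAt V Λ a) (ξ : W) :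
    vel Λ a ξ ∈ holVF V Y := by
  intro y x hx
  apply DifferentiableAt.differentiableWithinAt
  set e := chartAt V y
  have h1 : ∀ x ∈ e.target, ContDiffAt ℂ ω
      (fun q : W × V => e (Λ q.1 ((Λ a)⁻¹ (e.symm q.2)))) (a, x) := by
    intro x hx
    have hsymm : ContMDiffAt 𝓘(ℂ, V) 𝓘(ℂ, V) ω e.symm x :=
      (contMDiffOn_chart_symm (I := 𝓘(ℂ, V)) (n := ω)).contMDiffAt (e.open_target.mem_nhds hx)
    have h2 : ContMDiffAt 𝓘(ℂ, W × V) (𝓘(ℂ, W).prod 𝓘(ℂ, V)) ω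
        (fun q : W × V => (q.1, (Λ a)⁻¹ (e.symm q.2))) (a, x) := by
      rw [modelWithCornersSelf_prod, ← chartedSpaceSelf_prod]
      exact contMDiffAt_fst.prodMk (((h.const a).inv.apply' (e.symm x)).comp (a, x)
        (hsymm.comp (a, x) contMDiffAt_snd))
    have h3 : ContMDiffAt 𝓘(ℂ, W × V) 𝓘(ℂ, V) ω
        (fun q : W × V => Λ q.1 ((Λ a)⁻¹ (e.symm q.2))) (a, x) :=
      ContMDiffAt.comp (a, x) (g := fun q : W × Y => Λ q.1 q.2)
        (f := fun q : W × V => (q.1, (Λ a)⁻¹ (e.symm q.2))) (h _).1 h2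
    exact contDiffAt_chart_comp h3 (by simpa using e.map_target hx)
  have h4 : DifferentiableAt ℂ (fun x' =>
      fderiv ℂ (fun q : W × V => e (Λ q.1 ((Λ a)⁻¹ (e.symm q.2)))) (a, x') (ξ, 0)) x := by
    have h5 := ((h1 x hx).fderiv_right (m := ω) (by simp)).differentiableAt (by simp)
    have h6 : DifferentiableAt ℂ (fun x' : V => (a, x')) x := by fun_prop
    exact (DifferentiableAt.comp (f := fun x' : V => (a, x')) x h5 h6).clm_apply
      (differentiableAt_const _)
  refine h4.congr_of_eventuallyEq ?_
  filter_upwards [e.open_target.mem_nhds hx] with x' hx'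
  have hz : Λ a ((Λ a)⁻¹ (e.symm x')) ∈ (chartAt V y).source := by simpa using e.map_target hx'
  have h7 := fderiv_chart_eq_vel h hz ξ
  rw [show Λ a ((Λ a)⁻¹ (e.symm x')) = e.symm x' by simp] at h7
  rw [vfRep_apply, ← h7]
  have h8 := HasFDerivAt.comp (f := fun b : W => (b, x')) a
    ((h1 x' hx').differentiableAt (by simp)).hasFDerivAt
    ((hasFDerivAt_id a).prodMk (hasFDerivAt_const x' a))
  simp only [Function.comp_def] at h8
  rw [h8.fderiv]
  simp

/-- On a compact manifold, a holomorphic vector field is determined by its values at finitely many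
suitable points. -/
theorem exists_finset_determining_holVF [FiniteDimensional ℂ V] [T2Space Y] [CompactSpace Y] :
    ∃ P : Finset Y, ∀ v ∈ holVF V Y, (∀ p ∈ P, v p = 0) → v = 0 := by
  classical
  have : IsManifold 𝓘(ℂ, V) 1 Y := IsManifold.of_le (n := ω) le_top
  have : ProperSpace V := FiniteDimensional.proper ℂ V
  -- Three radii are nested: the closed balls `D y` of radius `r` cover `Y`, the Schwarz lemma is
  -- used on balls of radius `2 * r` centred in them, and those stay within radius `3 * r`.
  have hr : ∀ y : Y, ∃ r : ℝ, 0 < r ∧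
      Metric.closedBall (chartAt V y y) (3 * r) ⊆ (chartAt V y).target := by
    intro y
    obtain ⟨ε, hε, h⟩ := Metric.nhds_basis_closedBall.mem_iff.1
      ((chartAt V y).open_target.mem_nhds (mem_chart_target V y))
    exact ⟨ε / 3, by positivity, by rwa [mul_div_cancel₀ _ (by norm_num)]⟩
  choose r hr0 hrt using hr
  let D : Y → Set V := fun y => Metric.closedBall (chartAt V y y) (r y)
  have hD3 : ∀ y, D y ⊆ Metric.closedBall (chartAt V y y) (3 * r y) := fun y =>
    Metric.closedBall_subset_closedBall (by linarith [hr0 y])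
  have hDt : ∀ y, D y ⊆ (chartAt V y).target := fun y => (hD3 y).trans (hrt y)
  let K : Y → Set Y := fun y => (chartAt V y).symm '' D y
  have hKn : ∀ y, K y ∈ 𝓝 y := by
    intro y
    have := (chartAt V y).symm.image_mem_nhds (x := chartAt V y y) (by simp)
      (Metric.closedBall_mem_nhds _ (hr0 y))
    simpa using this
  obtain ⟨t, -, ht⟩ := isCompact_univ.elim_nhds_subcover K (fun y _ => hKn y)
  have hcomp : ∀ (y : Y) (A : Set V), IsCompact A → A ⊆ (chartAt V y).target →
      IsCompact ((chartAt V y).symm '' A) := fun y A hA hAt =>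
    hA.image_of_continuousOn ((chartAt V y).continuousOn_symm.mono hAt)
  have hC : ∀ i j : Y, ∃ C : ℝ, ∀ z ∈ (chartAt V i).symm ''
      Metric.closedBall (chartAt V i i) (3 * r i) ∩ K j,
      ‖tangentCoordChange 𝓘(ℂ, V) j i z‖ ≤ C := by
    intro i j
    refine IsCompact.exists_bound_of_continuousOn
      ((hcomp i _ (isCompact_closedBall _ _) (hrt i)).inter
        (hcomp j _ (isCompact_closedBall _ _) (hDt j))) ?_
    refine (continuousOn_tangentCoordChange j i).mono ?_
    rintro z ⟨⟨x, hx, rfl⟩, x', hx', h⟩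
    have h1 := (chartAt V i).map_target (hrt i hx)
    have h2 := (chartAt V j).map_target (hDt j hx')
    rw [h] at h2
    simp [h1, h2]
  choose C₀ hC₀ using hC
  obtain ⟨C₁, hC₁⟩ := ((t ×ˢ t).image fun q => C₀ q.1 q.2).exists_le
  let C := max C₁ 1
  have hC1 : 1 ≤ C := le_max_right _ _
  have hC : ∀ i ∈ t, ∀ j ∈ t, ∀ z ∈ (chartAt V i).symm ''
      Metric.closedBall (chartAt V i i) (3 * r i) ∩ K j,
      ‖tangentCoordChange 𝓘(ℂ, V) j i z‖ ≤ C := fun i hi j hj z hz =>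
    (hC₀ i j z hz).trans ((hC₁ _ (Finset.mem_image.2 ⟨(i, j), by simp [hi, hj], rfl⟩)).trans
      (le_max_left _ _))
  -- The mesh is chosen against the bound `C` on coordinate changes, so that the Schwarz estimate
  -- below gains a factor `1 / 2`.
  have hnet : ∀ i, ∃ N : Finset V, (N : Set V) ⊆ D i ∧
      ∀ x ∈ D i, ∃ p ∈ N, dist x p < r i / (2 * C) := by
    intro i
    obtain ⟨N, hN, hfin, hcov⟩ := finite_cover_balls_of_compact
      (isCompact_closedBall (chartAt V i i) (r i))
      (show 0 < r i / (2 * C) by have := hr0 i; positivity)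
    refine ⟨hfin.toFinset, by simpa using hN, fun x hx => ?_⟩
    simpa using hcov hx
  choose N hND hN using hnet
  refine ⟨t.biUnion fun i => (N i).image (chartAt V i).symm, fun v hv hvP => ?_⟩
  have hzero : ∀ i ∈ t, ∀ p ∈ N i, vfRep i v p = 0 := fun i hi p hp =>
    (vfRep_eq_zero_iff (hDt i (hND i hp))).2 (hvP _ (by
      simp only [Finset.mem_biUnion, Finset.mem_image]; exact ⟨i, hi, p, hp, rfl⟩))
  have hmax : ∀ i, ∃ x ∈ D i, ∀ x' ∈ D i, ‖vfRep i v x'‖ ≤ ‖vfRep i v x‖ := fun i =>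
    (isCompact_closedBall _ _).exists_isMaxOn ⟨_, Metric.mem_closedBall_self (hr0 i).le⟩
      ((hv i).continuousOn.mono (hDt i)).norm
  choose m hmD hm using hmax
  rcases t.eq_empty_or_nonempty with rfl | hne
  · ext y; simpa using ht (Set.mem_univ y)
  obtain ⟨i, hi, himax⟩ := t.exists_max_image (fun i => ‖vfRep i v (m i)‖) hne
  set M := ‖vfRep i v (m i)‖ with hM
  -- A point of the larger ball lies in some `K j`, where the field is at most `M` in the `j`-th
  -- coordinates; changing coordinates costs at most `C`.
  have hbound : ∀ x ∈ Metric.closedBall (chartAt V i i) (3 * r i), ‖vfRep i v x‖ ≤ C * M := by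
    intro x hx
    obtain ⟨j, hj, x', hx', hxx'⟩ : ∃ j ∈ t, (chartAt V i).symm x ∈ K j := by
      simpa using ht (Set.mem_univ ((chartAt V i).symm x))
    have hsrc : (chartAt V i).symm x ∈ (chartAt V j).source := by
      rw [← hxx']; exact (chartAt V j).map_target (hDt j hx')
    rw [vfRep_change (hrt i hx) hsrc]
    refine (ContinuousLinearMap.le_opNorm _ _).trans ?_
    gcongr
    · exact hC i hi j hj _ ⟨⟨x, hx, rfl⟩, x', hx', hxx'⟩
    · rw [← hxx', (chartAt V j).right_inv (hDt j hx')]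
      exact (hm j x' hx').trans (himax j hj)
  have hM0 : M = 0 := by
    by_contra hne0
    have hMpos : 0 < M := lt_of_le_of_ne (norm_nonneg _) (Ne.symm hne0)
    obtain ⟨p, hp, hdist⟩ := hN i (m i) (hmD i)
    have hri := hr0 i
    have hsub : Metric.ball p (2 * r i) ⊆ Metric.closedBall (chartAt V i i) (3 * r i) := by
      intro x hx
      have h1 : dist p (chartAt V i i) ≤ r i := hND i hp
      have h2 : dist x p < 2 * r i := hx
      exact (dist_triangle x p _).trans (by linarith)
    have hδ : r i / (2 * C) ≤ r i / 2 := by gcongr; linarith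
    -- The field vanishes at the net point `p`, so Schwarz on the ball of radius `2 * r i` about `p`
    -- gives `M < M / 2` at the maximum point `m i`.
    have hS := Complex.dist_le_div_mul_dist_of_mapsTo_ball (f := vfRep i v) (c := p) (z := m i)
      (R₁ := 2 * r i) (R₂ := 2 * C * M) ((hv i).mono (hsub.trans (hrt i)))
      (fun x hx => by
        rw [hzero i hi p hp, mem_closedBall_zero_iff]
        exact (hbound x (hsub hx)).trans (by nlinarith))
      (by rw [Metric.mem_ball]; linarith)
    rw [hzero i hi p hp, dist_zero_right, ← hM] at hS
    have : 2 * C * M / (2 * r i) * dist (m i) p < 2 * C * M / (2 * r i) * (r i / (2 * C)) := by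
      gcongr
    have h3 : 2 * C * M / (2 * r i) * (r i / (2 * C)) = M / 2 := by field_simp
    linarith
  ext y
  obtain ⟨j, hj, x, hx, rfl⟩ : ∃ j ∈ t, y ∈ K j := by simpa using ht (Set.mem_univ y)
  have h1 : ‖vfRep j v x‖ ≤ 0 := ((hm j x hx).trans (himax j hj)).trans hM0.le
  simpa using (vfRep_eq_zero_iff (hDt j hx)).1 (norm_le_zero_iff.1 h1)

end HolomorphicVectorFields

lemma exists_localInverse {E E' : Type*} [NormedAddCommGroup E] [NormedSpace ℂ E]
    [NormedAddCommGroup E'] [NormedSpace ℂ E'] [CompleteSpace E] [CompleteSpace E']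
    {f : E → E'} {a : E} (hf : ContDiffAt ℂ ω f a) (hf' : Function.Bijective (fderiv ℂ f a)) :
    ∃ e : OpenPartialHomeomorph E E', (e : E → E') = f ∧ a ∈ e.source ∧
      ContDiffAt ℂ ω e.symm (f a) := by
  let L := ContinuousLinearEquiv.ofBijective (fderiv ℂ f a) (LinearMap.ker_eq_bot.2 hf'.1)
    (LinearMap.range_eq_top.2 hf'.2)
  have hL : HasFDerivAt f (L : E →L[ℂ] E') a := (hf.differentiableAt (by simp)).hasFDerivAt
  exact ⟨hf.toOpenPartialHomeomorph f hL (by simp), rfl,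
    hf.mem_toOpenPartialHomeomorph_source hL (by simp), hf.to_localInverse hL (by simp)⟩

/-! ### Realised velocities and families that factor through `φ` -/

section Integration

variable {V : Type*} [NormedAddCommGroup V] [NormedSpace ℂ V]
  {Y : Type u} [TopologicalSpace Y] [ChartedSpace V Y] [IsManifold 𝓘(ℂ, V) ω Y]
  {W : Type*} [NormedAddCommGroup W] [NormedSpace ℂ W]
  {Z : Type*} [NormedAddCommGroup Z] [NormedSpace ℂ Z]

variable (V Y) in
/-- The space of velocities at the identity of holomorphic one-parameter families of
automorphisms. -/
noncomputable def autVF : Submodule ℂ (Y → V) where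
  carrier := {v | ∃ c : ℂ → Equiv.Perm Y, HolAt V c 0 ∧ c 0 = 1 ∧ vel c 0 1 = v}
  add_mem' := by
    rintro _ _ ⟨c, hc, hc1, rfl⟩ ⟨d, hd, hd1, rfl⟩
    exact ⟨fun z => c z * d z, hc.mul hd, by simp [hc1, hd1],
      by rw [vel_mul_of_eq_one hc hd hc1 hd1]; rfl⟩
  zero_mem' := ⟨fun _ => 1, HolAt.one 0, rfl, by ext y; simp [vel_apply]⟩
  smul_mem' := by
    rintro k _ ⟨c, hc, hc1, rfl⟩
    have hτ : ContDiff ℂ ω fun z : ℂ => k * z := by fun_prop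
    refine ⟨fun z => c (k * z), HolAt.comp_param (τ := fun z => k * z) hτ.contDiffAt
      (by simpa using hc), by simp [hc1], ?_⟩
    rw [vel_comp_param (by simpa using hc) (hτ.differentiable (by simp) 0), mul_zero,
      ← map_smul]
    congr 1
    simp

/-- Restricting `Λ` to the line through `a` in direction `ξ` and multiplying on the right by `(Λ
a)⁻¹` starts the family at `1` without changing its velocity. -/
lemma vel_mem_autVF {Λ : W → Equiv.Perm Y} {a : W} (h : HolAt V Λ a) (ξ : W) :
    vel Λ a ξ ∈ autVF V Y := by
  have hτ : ContDiff ℂ ω fun z : ℂ => a + z • ξ := by fun_prop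
  have h1 : HolAt V (fun z : ℂ => Λ (a + z • ξ)) 0 :=
    HolAt.comp_param (τ := fun z : ℂ => a + z • ξ) hτ.contDiffAt (by simpa using h)
  refine ⟨fun z => Λ (a + z • ξ) * (Λ a)⁻¹, h1.mul (h.const 0).inv, by simp, ?_⟩
  rw [vel_mul_const, vel_comp_param (by simpa using h) (hτ.differentiable (by simp) 0), zero_smul,
    add_zero]
  congr 1
  have : HasDerivAt (fun z : ℂ => a + z • ξ) ((1 : ℂ) • ξ) 0 :=
    ((hasDerivAt_id (0 : ℂ)).smul_const ξ).const_add a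
  simpa using this.deriv

lemma autVF_le_holVF [CompleteSpace V] : autVF V Y ≤ holVF V Y := by
  rintro _ ⟨c, hc, -, rfl⟩
  exact vel_mem_holVF hc 1

/-- Canonical coordinates of the second kind: the product of one-parameter families, the `i`-th
evaluated at `t i`. Velocities at the identity add, so the order of the factors does not matter to
first order. -/
lemma exists_family_of_velocities {m : ℕ} (v : Fin m → Y → V) (hv : ∀ i, v i ∈ autVF V Y) :
    ∃ φ : EuclideanSpace ℂ (Fin m) → Equiv.Perm Y, HolAt V φ 0 ∧ φ 0 = 1 ∧
      ∀ ξ, vel φ 0 ξ = ∑ i, ξ i • v i := by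
  choose c hc hc1 hcv using hv
  let Φ : Fin m → EuclideanSpace ℂ (Fin m) → Equiv.Perm Y := fun i t => c i (t i)
  have hΦ : ∀ i, HolAt V (Φ i) 0 := fun i =>
    HolAt.comp_param (τ := fun t : EuclideanSpace ℂ (Fin m) => t i)
      (EuclideanSpace.proj (𝕜 := ℂ) i).contDiff.contDiffAt (hc i)
  have hΦ1 : ∀ i, Φ i 0 = 1 := fun i => hc1 i
  have hmem : ∀ Ψ ∈ List.ofFn Φ, HolAt V Ψ 0 ∧ Ψ 0 = 1 := by
    intro Ψ hΨ
    obtain ⟨i, rfl⟩ := (List.mem_ofFn' _ _).1 hΨ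
    exact ⟨hΦ i, hΦ1 i⟩
  refine ⟨fun t => ((List.ofFn Φ).map fun Ψ => Ψ t).prod,
    HolAt.list_prod fun Ψ hΨ => (hmem Ψ hΨ).1, ?_, fun ξ => ?_⟩
  · exact List.prod_eq_one (by simpa using hΦ1)
  · rw [vel_list_prod hmem, List.map_ofFn, List.sum_ofFn, LinearMap.sum_apply]
    refine Finset.sum_congr rfl fun i _ => ?_
    have hp : HasFDerivAt (fun t : EuclideanSpace ℂ (Fin m) => t i)
      (EuclideanSpace.proj (𝕜 := ℂ) i) 0 := (EuclideanSpace.proj (𝕜 := ℂ) i).hasFDerivAt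
    have := vel_comp_param (τ := fun t : EuclideanSpace ℂ (Fin m) => t i) (hc i)
      hp.differentiableAt ξ
    rw [hp.fderiv] at this
    change vel (Φ i) 0 ξ = _
    rw [this, ← hcv i, ← map_smul]
    simp

/-- Linear coordinates of the images of finitely many points under a permutation close to `1`. -/
noncomputable def readout {P : Finset Y} (l : (P → V) →L[ℂ] Z) (g : Equiv.Perm Y) : Z :=
  l fun p => chartAt V (p : Y) (g p)

/-- The action of a vector field on `readout`. -/
noncomputable def readoutVF {P : Finset Y} (l : (P → V) →L[ℂ] Z) (g : Equiv.Perm Y) :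
    (Y → V) →ₗ[ℂ] Z where
  toFun v := l fun p => tangentCoordChange 𝓘(ℂ, V) (g p) (p : Y) (g p) (v (g p))
  map_add' v w := by rw [← map_add]; congr 1; ext p; simp
  map_smul' c v := by rw [RingHom.id_apply, ← map_smul]; congr 1; ext p; simp

section

variable {P : Finset Y} {l : (P → V) →L[ℂ] Z} {Λ : W → Equiv.Perm Y} {a : W}

lemma contDiffAt_readout (h : HolAt V Λ a) (hs : ∀ p ∈ P, Λ a p ∈ (chartAt V p).source) :
    ContDiffAt ℂ ω (fun b => readout l (Λ b)) a :=
  l.contDiff.contDiffAt.comp a (contDiffAt_pi.2 fun p =>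
    contDiffAt_chart_comp (h.apply (p : Y)) (hs p p.2))

lemma fderiv_readout (h : HolAt V Λ a) (hs : ∀ p ∈ P, Λ a p ∈ (chartAt V p).source) (ξ : W) :
    fderiv ℂ (fun b => readout l (Λ b)) a ξ = readoutVF l (Λ a) (vel Λ a ξ) := by
  have h1 : ∀ p : P, DifferentiableAt ℂ (fun b => chartAt V (p : Y) (Λ b p)) a := fun p =>
    (contDiffAt_chart_comp (h.apply (p : Y)) (hs p p.2)).differentiableAt (by simp)
  have h2 := l.hasFDerivAt.comp a (hasFDerivAt_pi.2 fun p => (h1 p).hasFDerivAt)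
  have h3 : fderiv ℂ (fun b => readout l (Λ b)) a = _ := h2.fderiv
  rw [h3]
  simp only [readoutVF, ContinuousLinearMap.comp_apply, LinearMap.coe_mk, AddHom.coe_mk]
  congr 1
  ext p
  exact fderiv_chart_eq_vel h (hs p p.2) ξ

/-- The derivative of the readout factors as `readoutVF` after `vel`. Its surjectivity makes
`readoutVF` map `autVF` onto `Z`; the dimensions agree, so that map is injective. -/
lemma vel_eq_zero_of_fderiv_readout [FiniteDimensional ℂ (autVF V Y)] [FiniteDimensional ℂ Z]
    (hdim : Module.finrank ℂ (autVF V Y) = Module.finrank ℂ Z)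
    (h : HolAt V Λ a) (hs : ∀ p ∈ P, Λ a p ∈ (chartAt V p).source)
    (hsurj : Function.Surjective (fderiv ℂ (fun b => readout l (Λ b)) a)) {ξ : W}
    (hξ : fderiv ℂ (fun b => readout l (Λ b)) a ξ = 0) : vel (V := V) Λ a ξ = 0 := by
  let D : autVF V Y →ₗ[ℂ] Z := (readoutVF l (Λ a)).domRestrict (autVF V Y)
  have hD : Function.Surjective D := by
    intro z
    obtain ⟨η, rfl⟩ := hsurj z
    exact ⟨⟨vel Λ a η, vel_mem_autVF h η⟩, (fderiv_readout h hs η).symm⟩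
  have hDi := (LinearMap.injective_iff_surjective_of_finrank_eq_finrank hdim).2 hD
  have : (⟨vel Λ a ξ, vel_mem_autVF h ξ⟩ : autVF V Y) = 0 := by
    apply hDi
    rw [map_zero, ← hξ]
    exact (fderiv_readout h hs ξ).symm
  exact congrArg Subtype.val this

end

/-- A holomorphic family passing through `φ t₀`, where `φ` is a family whose velocities span all
velocities, is locally a reparametrization of `φ`. -/
theorem exists_reparametrization [CompactSpace Y] [FiniteDimensional ℂ V]
    [FiniteDimensional ℂ (autVF V Y)] [FiniteDimensional ℂ Z] [CompleteSpace W]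
    (hdim : Module.finrank ℂ (autVF V Y) = Module.finrank ℂ Z)
    {P : Finset Y} {l : (P → V) →L[ℂ] Z} {φ : Z → Equiv.Perm Y} {t₀ : Z} (hφ : HolAt V φ t₀)
    (hs : ∀ p ∈ P, φ t₀ p ∈ (chartAt V p).source)
    (hu : IsUnit (fderiv ℂ (fun t => readout l (φ t)) t₀))
    {Ψ : W → Equiv.Perm Y} {w₀ : W} (hΨ : HolAt V Ψ w₀) (h0 : Ψ w₀ = φ t₀) :
    ∃ τ : W → Z, ContDiffAt ℂ ω τ w₀ ∧ τ w₀ = t₀ ∧ ∀ᶠ w in 𝓝 w₀, Ψ w = φ (τ w) := by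
  have : CompleteSpace V := FiniteDimensional.complete ℂ V
  have : CompleteSpace Z := FiniteDimensional.complete ℂ Z
  -- This family contains both others: it restricts to `φ` on `w = w₀` and to `Ψ` on `t = t₀`. The
  -- aim is that `Λ` depends locally only on its readout `K`.
  let Λ : W × Z → Equiv.Perm Y := fun q => Ψ q.1 * (φ t₀)⁻¹ * φ q.2
  have hΛ : HolAt V Λ (w₀, t₀) :=
    ((HolAt.comp_param (τ := Prod.fst) (w := (w₀, t₀)) contDiffAt_fst hΨ).mul
      (hφ.const (w₀, t₀)).inv).mul (HolAt.comp_param (τ := Prod.snd) contDiffAt_snd hφ)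
  have hΛ1 : ∀ t, Λ (w₀, t) = φ t := fun t => by simp [Λ, h0]
  have hΛ2 : ∀ w, Λ (w, t₀) = Ψ w := fun w => by simp [Λ]
  have hsΛ : ∀ p ∈ P, Λ (w₀, t₀) p ∈ (chartAt V p).source := by simpa only [hΛ1] using hs
  let K : W × Z → Z := fun q => readout l (Λ q)
  have hK : ContDiffAt ℂ ω K (w₀, t₀) := contDiffAt_readout hΛ hsΛ
  have hKinr : (fderiv ℂ K (w₀, t₀)).comp (.inr ℂ W Z) =
      fderiv ℂ (fun t => readout l (φ t)) t₀ := by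
    have := HasFDerivAt.comp (f := fun t : Z => (w₀, t)) t₀
      (hK.differentiableAt (by simp)).hasFDerivAt (hasFDerivAt_prodMk_right w₀ t₀)
    simp only [Function.comp_def, K, hΛ1] at this
    exact this.fderiv.symm
  have hgood : ∀ᶠ q in 𝓝 (w₀, t₀), HolAt V Λ q ∧ (∀ p ∈ P, Λ q p ∈ (chartAt V p).source) ∧
      Function.Surjective (fderiv ℂ K q) := by
    refine hΛ.eventually.and (((Finset.eventually_all P).2 fun p hp =>
      (hΛ.apply p).continuousAt.preimage_mem_nhds
        ((chartAt V p).open_source.mem_nhds (hsΛ p hp))).and ?_)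
    have hc : ContinuousAt (fun q => (fderiv ℂ K q).comp (.inr ℂ W Z)) (w₀, t₀) :=
      ((hK.fderiv_right (m := ω) (by simp)).continuousAt).clm_comp continuousAt_const
    have hop : IsOpen {x : Z →L[ℂ] Z | IsUnit x} := Units.isOpen
    filter_upwards [hc.preimage_mem_nhds (hop.mem_nhds (by rw [Set.mem_ofPred, hKinr]; exact hu))]
      with q hq
    have hb := (ContinuousLinearMap.isUnit_iff_bijective.1 hq).2
    intro z
    obtain ⟨x, hx⟩ := hb z
    exact ⟨_, hx⟩
  -- The partial derivative of `K` in `Z` is invertible, so `(w, K)` are local coordinates on `W ×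
  -- Z`.
  let H : W × Z → W × Z := fun q => (q.1, K q)
  have hH : ContDiffAt ℂ ω H (w₀, t₀) := contDiffAt_fst.prodMk hK
  have hHd : fderiv ℂ H (w₀, t₀) = (ContinuousLinearMap.fst ℂ W Z).prod (fderiv ℂ K (w₀, t₀)) :=
    (hasFDerivAt_fst.prodMk (hK.differentiableAt (by simp)).hasFDerivAt).fderiv
  have hHb : Function.Bijective (fderiv ℂ H (w₀, t₀)) := by
    have hb := ContinuousLinearMap.isUnit_iff_bijective.1 hu
    rw [← hKinr] at hb
    rw [hHd]
    constructor
    · rw [injective_iff_map_eq_zero]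
      rintro ⟨w, z⟩ hwz
      simp only [ContinuousLinearMap.prod_apply, ContinuousLinearMap.coe_fst', Prod.mk_eq_zero]
        at hwz
      obtain ⟨rfl, hz⟩ := hwz
      have : z = 0 := (injective_iff_map_eq_zero _).1 hb.1 z (by simpa using hz)
      rw [this]; rfl
    · rintro ⟨w, z⟩
      obtain ⟨x, hx⟩ := hb.2 (z - fderiv ℂ K (w₀, t₀) (w, 0))
      refine ⟨(w, x), ?_⟩
      have h1 : fderiv ℂ K (w₀, t₀) (w, x) =
          fderiv ℂ K (w₀, t₀) (w, 0) + fderiv ℂ K (w₀, t₀) (0, x) := by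
        rw [← map_add]; simp
      have h2 : fderiv ℂ K (w₀, t₀) (0, x) = z - fderiv ℂ K (w₀, t₀) (w, 0) := by simpa using hx
      simp [h1, h2]
  obtain ⟨e, heH, hemem, hesymm⟩ := exists_localInverse hH hHb
  set u₀ := K (w₀, t₀) with hu₀
  have heu : e (w₀, t₀) = (w₀, u₀) := by rw [heH]
  have hH0 : H (w₀, t₀) = (w₀, u₀) := rfl
  rw [hH0] at hesymm
  have hes : e.symm (w₀, u₀) = (w₀, t₀) := by rw [← heu, e.left_inv hemem]
  have hev : ∀ᶠ x in 𝓝 (w₀, u₀), x ∈ e.target ∧ ContDiffAt ℂ ω e.symm x ∧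
      (HolAt V Λ (e.symm x) ∧ (∀ p ∈ P, Λ (e.symm x) p ∈ (chartAt V p).source) ∧
      Function.Surjective (fderiv ℂ K (e.symm x))) := by
    refine Filter.Eventually.and (e.open_target.mem_nhds (by rw [← heu]; exact e.map_source hemem))
      ((hesymm.eventually (by simp)).and ?_)
    exact hesymm.continuousAt.eventually (by rw [hes]; exact hgood)
  obtain ⟨r, hr, hball⟩ := Metric.eventually_nhds_iff_ball.1 hev
  -- Along `w ↦ e.symm (w, u)` the readout is constantly `u`, so by the dimension count the velocity
  -- vanishes and every point of `Y` stays fixed along the path.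
  have hconst : ∀ w ∈ Metric.ball w₀ r, ∀ u ∈ Metric.ball u₀ r,
      Λ (e.symm (w, u)) = Λ (e.symm (w₀, u)) := by
    intro w hw u hu
    ext1 y
    have hmem : ∀ w ∈ Metric.ball w₀ r, (w, u) ∈ Metric.ball (w₀, u₀) r := fun w hw => by
      rw [← ball_prod_same]; exact ⟨hw, hu⟩
    let α : W → W × Z := fun w => e.symm (w, u)
    have hα : ∀ w ∈ Metric.ball w₀ r, ContDiffAt ℂ ω α w := fun w hw =>
      (hball _ (hmem w hw)).2.1.comp w (contDiffAt_id.prodMk contDiffAt_const)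
    have hΛα : ∀ w ∈ Metric.ball w₀ r, HolAt V (fun w => Λ (α w)) w := fun w hw =>
      HolAt.comp_param (hα w hw) (hball _ (hmem w hw)).2.2.1
    have hKα : ∀ w ∈ Metric.ball w₀ r, K (α w) = u := fun w hw => by
      have := e.right_inv (hball _ (hmem w hw)).1
      rw [heH] at this
      exact congrArg Prod.snd this
    refine eq_of_fderiv_chart_eq_zero (V := V) Metric.isOpen_ball (convex_ball w₀ r).isPreconnected
      (γ := fun w => Λ (α w) y) (fun b hb => (hΛα b hb).apply y) ?_ hw (Metric.mem_ball_self hr)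
    intro b hb
    ext ξ
    have h1 := vel_apply_image (V := V) (fun w => Λ (α w)) b ξ y
    have h2 := vel_comp_param (τ := α) (hball _ (hmem b hb)).2.2.1
      ((hα b hb).differentiableAt (by simp)) ξ
    refine h1.symm.trans ?_
    rw [h2, vel_eq_zero_of_fderiv_readout (l := l) hdim (hball _ (hmem b hb)).2.2.1
        (hball _ (hmem b hb)).2.2.2.1 (hball _ (hmem b hb)).2.2.2.2]
    · simp
    · have hKd : DifferentiableAt ℂ K (α b) :=
        (contDiffAt_readout (hball _ (hmem b hb)).2.2.1
          (hball _ (hmem b hb)).2.2.2.1).differentiableAt (by simp)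
      have h2 := fderiv_comp b hKd ((hα b hb).differentiableAt (by simp))
      have h3 : fderiv ℂ (K ∘ α) b = 0 := by
        have : K ∘ α =ᶠ[𝓝 b] fun _ => u := by
          filter_upwards [Metric.isOpen_ball.mem_nhds hb] with b' hb' using hKα b' hb'
        rw [this.fderiv_eq]; simp
      rw [h3] at h2
      exact (congrArg (fun L : W →L[ℂ] Z => L ξ) h2).symm
  have hKw : ContDiffAt ℂ ω (fun w => K (w, t₀)) w₀ :=
    ContDiffAt.comp w₀ (g := K) (f := fun w : W => (w, t₀)) hK
      (contDiffAt_id.prodMk contDiffAt_const)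
  -- Slide `(w, t₀)` within its level set of `K` to the slice over `w₀`: there `Λ` is still `Ψ w`,
  -- but it is now a value of `φ`.
  refine ⟨fun w => (e.symm (w₀, K (w, t₀))).2, ?_, ?_, ?_⟩
  · exact contDiffAt_snd.comp w₀ (ContDiffAt.comp w₀ (g := e.symm)
      (f := fun w => (w₀, K (w, t₀))) hesymm (contDiffAt_const.prodMk hKw))
  · simp [← hu₀, hes]
  · have hsrc : ∀ᶠ w in 𝓝 w₀, (w, t₀) ∈ e.source :=
      (Continuous.prodMk_left t₀).continuousAt.preimage_mem_nhds (e.open_source.mem_nhds hemem)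
    filter_upwards [hsrc, Metric.ball_mem_nhds w₀ hr,
      hKw.continuousAt.preimage_mem_nhds (Metric.ball_mem_nhds u₀ hr)] with w hw1 hw2 hw3
    have h1 : e.symm (w, K (w, t₀)) = (w, t₀) := by
      have := e.left_inv hw1
      rwa [heH] at this
    have h2 := hconst w hw2 _ hw3
    rw [h1, hΛ2] at h2
    have h3 : (e.symm (w₀, K (w, t₀))).1 = w₀ := by
      have := e.right_inv (hball (w₀, K (w, t₀))
        (by rw [← ball_prod_same]; exact ⟨Metric.mem_ball_self hr, hw3⟩)).1
      rw [heH] at this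
      exact congrArg Prod.fst this
    rw [h2, ← hΛ1]
    congr 1
    exact Prod.ext h3 rfl

end Integration

/-! ### A local chart of automorphisms -/

section LocalChart

variable {V : Type*} [NormedAddCommGroup V] [NormedSpace ℂ V] [FiniteDimensional ℂ V]
  {Y : Type u} [TopologicalSpace Y] [ChartedSpace V Y] [IsManifold 𝓘(ℂ, V) ω Y]
  [T2Space Y] [CompactSpace Y]

variable (V Y) in
lemma exists_finset_injective_eval : ∃ P : Finset Y,
    LinearMap.ker ((LinearMap.funLeft ℂ V (Subtype.val : P → Y)).domRestrict (autVF V Y)) = ⊥ := by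
  have : CompleteSpace V := FiniteDimensional.complete ℂ V
  obtain ⟨P, hP⟩ := exists_finset_determining_holVF (V := V) (Y := Y)
  refine ⟨P, LinearMap.ker_eq_bot.2 ((injective_iff_map_eq_zero _).2 fun v hv => ?_)⟩
  exact Subtype.ext (hP v (autVF_le_holVF v.2) fun p hp => congrFun hv ⟨p, hp⟩)

variable (V Y) in
lemma finiteDimensional_autVF : FiniteDimensional ℂ (autVF V Y) := by
  obtain ⟨P, hP⟩ := exists_finset_injective_eval V Y
  exact FiniteDimensional.of_injective _ (LinearMap.ker_eq_bot.1 hP)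

/-- A holomorphic family of automorphisms parametrized by an open neighbourhood of `0`, through
which every holomorphic family passing by one of its members factors. -/
structure IsLocalChart (V : Type*) [NormedAddCommGroup V] [NormedSpace ℂ V]
    {Y : Type*} [TopologicalSpace Y] [ChartedSpace V Y] {m : ℕ}
    (φ : EuclideanSpace ℂ (Fin m) → Equiv.Perm Y) (B : Set (EuclideanSpace ℂ (Fin m))) : Prop where
  isOpen : IsOpen B
  zero_mem : (0 : EuclideanSpace ℂ (Fin m)) ∈ B
  map_zero : φ 0 = 1
  injOn : Set.InjOn φ B
  holAt : ∀ t ∈ B, HolAt V φ t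
  -- Parameter spaces in `Type` suffice: the group laws only need `EuclideanSpace ℂ (Fin m)` and its
  -- square.
  factor : ∀ {W : Type} [NormedAddCommGroup W] [NormedSpace ℂ W] [CompleteSpace W]
    {Ψ : W → Equiv.Perm Y} {w : W} {t : EuclideanSpace ℂ (Fin m)}, t ∈ B → HolAt V Ψ w →
    Ψ w = φ t → ∃ τ : W → EuclideanSpace ℂ (Fin m), ContDiffAt ℂ ω τ w ∧ τ w = t ∧
      ∀ᶠ w' in 𝓝 w, Ψ w' = φ (τ w')

variable (V Y) in
theorem exists_isLocalChart : ∃ (m : ℕ) (φ : EuclideanSpace ℂ (Fin m) → Equiv.Perm Y)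
    (B : Set (EuclideanSpace ℂ (Fin m))), IsLocalChart V φ B ∧
      ∀ v ∈ autVF V Y, ∃ ξ, vel φ 0 ξ = v := by
  have : CompleteSpace V := FiniteDimensional.complete ℂ V
  have := finiteDimensional_autVF V Y
  obtain ⟨P, hev⟩ := exists_finset_injective_eval V Y
  set ev := (LinearMap.funLeft ℂ V (Subtype.val : P → Y)).domRestrict (autVF V Y)
  obtain ⟨g, hg⟩ := ev.exists_leftInverse_of_injective hev
  let m := Module.finrank ℂ (autVF V Y)
  let b := Module.finBasis ℂ (autVF V Y)
  let Z := EuclideanSpace ℂ (Fin m)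
  obtain ⟨φ, hφ, hφ1, hφv⟩ := exists_family_of_velocities (fun i => (b i : Y → V))
    fun i => (b i).2
  let c : autVF V Y ≃ₗ[ℂ] Z := b.equivFun.trans (WithLp.linearEquiv 2 ℂ (Fin m → ℂ)).symm
  -- Here `g` recovers a velocity from its values on `P` and `c` takes its coordinates, so the
  -- readout of `φ` has derivative the identity at `0`.
  let l : (P → V) →L[ℂ] Z := (c.toLinearMap ∘ₗ g).toContinuousLinearMap
  have hvel : ∀ ξ : Z, vel φ 0 ξ = (c.symm ξ : Y → V) := by
    intro ξ
    rw [hφv]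
    have : c.symm ξ = ∑ i, ξ i • b i := by
      simp only [c, LinearEquiv.trans_symm, LinearEquiv.symm_symm, LinearEquiv.trans_apply,
        Module.Basis.equivFun_symm_apply]
      rfl
    rw [this, Submodule.coe_sum]
    rfl
  have hs0 : ∀ p ∈ P, φ 0 p ∈ (chartAt V p).source := by simp [hφ1]
  let κ : Z → Z := fun t => readout l (φ t)
  have hκ : ContDiffAt ℂ ω κ 0 := contDiffAt_readout hφ hs0
  have hκd : fderiv ℂ κ 0 = ContinuousLinearMap.id ℂ Z := by
    ext1 ξ
    have : IsManifold 𝓘(ℂ, V) 1 Y := IsManifold.of_le (n := ω) le_top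
    have h1 : readoutVF l (φ 0) (vel φ 0 ξ) = c (g (ev (c.symm ξ))) := by
      rw [hvel]
      change c (g _) = _
      congr 2
      ext p
      rw [hφ1]
      exact tangentCoordChange_self (by simp)
    have h2 : g (ev (c.symm ξ)) = c.symm ξ := LinearMap.congr_fun hg _
    rw [fderiv_readout hφ hs0, h1, h2]
    simp
  have hop : IsOpen {x : Z →L[ℂ] Z | IsUnit x} := Units.isOpen
  have hunit : ∀ᶠ t in 𝓝 (0 : Z), IsUnit (fderiv ℂ κ t) :=
    (hκ.fderiv_right (m := ω) (by simp)).continuousAt.preimage_mem_nhds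
      (hop.mem_nhds (by rw [Set.mem_ofPred, hκd]; exact isUnit_one))
  have hs : ∀ᶠ t in 𝓝 (0 : Z), ∀ p ∈ P, φ t p ∈ (chartAt V p).source :=
    (Finset.eventually_all P).2 fun p hp => (hφ.apply p).continuousAt.preimage_mem_nhds
      ((chartAt V p).open_source.mem_nhds (hs0 p hp))
  obtain ⟨e, heκ, hemem, -⟩ := exists_localInverse hκ (by rw [hκd]; exact Function.bijective_id)
  obtain ⟨B, hB, hBo, h0B⟩ := eventually_nhds_iff.1
    ((hφ.eventually.and (hs.and hunit)).and (e.open_source.mem_nhds hemem))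
  refine ⟨m, φ, B, ⟨hBo, h0B, hφ1, fun t ht t' ht' h => ?_, fun t ht => (hB t ht).1.1,
    fun {W} _ _ _ Ψ w t ht hΨ h => ?_⟩, fun v hv => ⟨c ⟨v, hv⟩, by rw [hvel]; simp⟩⟩
  · refine e.injOn (hB t ht).2 (hB t' ht').2 ?_
    rw [heκ]
    simp only [κ, h]
  · exact exists_reparametrization (by simp) (hB t ht).1.1 (hB t ht).1.2.1
      (hB t ht).1.2.2 hΨ h

end LocalChart

/-! ### Self-maps close to the identity -/

section NearIdentity

variable {V : Type*} [NormedAddCommGroup V] [NormedSpace ℂ V] [CompleteSpace V]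
  {Y : Type u} [TopologicalSpace Y] [ChartedSpace V Y] [IsManifold 𝓘(ℂ, V) ω Y]
  {f : ℂ × Y → Y}

/-- As `f (0, ·)` is the identity, its space derivative in a chart is the identity too. Hence `(z,
x) ↦ (z, F (z, x))` has an analytic local inverse, which yields both local injectivity and the local
right inverse `g`. -/
lemma exists_local_param_inverse {y : Y}
    (hf : ContMDiffAt (𝓘(ℂ, ℂ).prod 𝓘(ℂ, V)) 𝓘(ℂ, V) ω f (0, y)) (h0 : ∀ y, f (0, y) = y) :
    (∀ᶠ q : ℂ × (Y × Y) in 𝓝 (0, y, y), f (q.1, q.2.1) = f (q.1, q.2.2) → q.2.1 = q.2.2) ∧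
    ∃ g : ℂ × Y → Y, ContMDiffAt (𝓘(ℂ, ℂ).prod 𝓘(ℂ, V)) 𝓘(ℂ, V) ω g (0, y) ∧
      ∀ᶠ q : ℂ × Y in 𝓝 (0, y), f (q.1, g q) = q.2 := by
  set c := chartAt V y
  have hy : y ∈ c.source := mem_chart_source V y
  have hsymm : ContMDiffAt 𝓘(ℂ, V) 𝓘(ℂ, V) ω c.symm (c y) :=
    (contMDiffOn_chart_symm (I := 𝓘(ℂ, V)) (n := ω)).contMDiffAt
      (c.open_target.mem_nhds (c.map_source hy))
  have hc : ContMDiffAt 𝓘(ℂ, V) 𝓘(ℂ, V) ω c y :=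
    (contMDiffOn_chart (I := 𝓘(ℂ, V)) (n := ω)).contMDiffAt (c.open_source.mem_nhds hy)
  have hpc : ContMDiffAt 𝓘(ℂ, ℂ × V) (𝓘(ℂ, ℂ).prod 𝓘(ℂ, V)) ω
      (fun q : ℂ × V => (q.1, c.symm q.2)) (0, c y) := by
    rw [modelWithCornersSelf_prod, ← chartedSpaceSelf_prod]
    exact contMDiffAt_fst.prodMk (hsymm.comp (0, c y) contMDiffAt_snd)
  have hfc : ContMDiffAt 𝓘(ℂ, ℂ × V) 𝓘(ℂ, V) ω (fun q : ℂ × V => f (q.1, c.symm q.2)) (0, c y) :=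
    ContMDiffAt.comp (0, c y) (g := f) (f := fun q : ℂ × V => (q.1, c.symm q.2))
      (by simpa only [c.left_inv hy] using hf) hpc
  let F : ℂ × V → V := fun q => c (f (q.1, c.symm q.2))
  have hF : ContDiffAt ℂ ω F (0, c y) :=
    contDiffAt_chart_comp hfc (by simp [h0, c.left_inv hy, c])
  have hFd := (hF.differentiableAt (by simp)).hasFDerivAt
  have hsnd : ∀ v, fderiv ℂ F (0, c y) (0, v) = v := by
    have h1 := HasFDerivAt.comp (f := fun x : V => ((0 : ℂ), x)) (c y) hFd
      (hasFDerivAt_prodMk_right 0 (c y))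
    have h2 : HasFDerivAt (fun x : V => x) ((fderiv ℂ F (0, c y)).comp (.inr ℂ ℂ V)) (c y) := by
      refine h1.congr_of_eventuallyEq ?_
      filter_upwards [c.open_target.mem_nhds (c.map_source hy)] with x hx
      simp [F, h0, c.right_inv hx]
    intro v
    have := congrArg (fun L : V →L[ℂ] V => L v) (h2.unique (hasFDerivAt_id _))
    simpa using this
  let H : ℂ × V → ℂ × V := fun q => (q.1, F q)
  have hH : ContDiffAt ℂ ω H (0, c y) := contDiffAt_fst.prodMk hF
  have hHd : fderiv ℂ H (0, c y) = (ContinuousLinearMap.fst ℂ ℂ V).prod (fderiv ℂ F (0, c y)) :=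
    (hasFDerivAt_fst.prodMk hFd).fderiv
  have hsplit : ∀ z v, fderiv ℂ F (0, c y) (z, v) = fderiv ℂ F (0, c y) (z, 0) + v := by
    intro z v
    conv_rhs => rw [← hsnd v, ← map_add]
    simp
  have hHb : Function.Bijective (fderiv ℂ H (0, c y)) := by
    rw [hHd]
    constructor
    · rintro ⟨z, v⟩ ⟨z', v'⟩ h
      simp only [ContinuousLinearMap.prod_apply, ContinuousLinearMap.coe_fst', Prod.mk.injEq] at h
      obtain ⟨rfl, h⟩ := h
      rw [hsplit z v, hsplit z v'] at h
      rw [add_left_cancel h]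
    · rintro ⟨z, v⟩
      refine ⟨(z, v - fderiv ℂ F (0, c y) (z, 0)), ?_⟩
      simp [hsplit z (v - _)]
  obtain ⟨e, heH, hemem, hesymm⟩ := exists_localInverse hH hHb
  have hH0 : H (0, c y) = (0, c y) := by simp [H, F, h0, c.left_inv hy]
  rw [hH0] at hesymm
  have heu : e (0, c y) = (0, c y) := by rw [heH, hH0]
  have hes : e.symm (0, c y) = (0, c y) := by
    conv_lhs => rw [← heu]
    exact e.left_inv hemem
  constructor
  · have hcc : ContinuousAt c y := c.continuousAt hy
    have hcont : ∀ p : ℂ × (Y × Y) → Y, ContinuousAt p (0, y, y) → p (0, y, y) = y →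
        ∀ᶠ q : ℂ × (Y × Y) in 𝓝 (0, y, y), p q ∈ c.source ∧ (q.1, c (p q)) ∈ e.source := by
      intro p hp hpy
      refine Filter.Eventually.and
        (hp.preimage_mem_nhds (c.open_source.mem_nhds (by rwa [hpy]))) ?_
      have h1 : ContinuousAt (fun q : ℂ × (Y × Y) => (q.1, c (p q))) (0, y, y) :=
        continuousAt_fst.prodMk (ContinuousAt.comp (by rwa [hpy]) hp)
      exact h1.preimage_mem_nhds (e.open_source.mem_nhds (by rwa [hpy]))
    filter_upwards [hcont (fun q => q.2.1) (by fun_prop) rfl,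
      hcont (fun q => q.2.2) (by fun_prop) rfl] with q h1 h2 hq
    have h3 : e (q.1, c q.2.1) = e (q.1, c q.2.2) := by
      simp only [heH, H, F, c.left_inv h1.1, c.left_inv h2.1, hq]
    exact c.injOn h1.1 h2.1 (congrArg Prod.snd (e.injOn h1.2 h2.2 h3))
  · have hce : ContMDiffAt (𝓘(ℂ, ℂ).prod 𝓘(ℂ, V)) 𝓘(ℂ, ℂ × V) ω
        (fun q : ℂ × Y => (q.1, c q.2)) (0, y) := by
      rw [modelWithCornersSelf_prod, ← chartedSpaceSelf_prod]
      exact contMDiffAt_fst.prodMk (hc.comp (0, y) contMDiffAt_snd)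
    have h1 : ContMDiffAt (𝓘(ℂ, ℂ).prod 𝓘(ℂ, V)) 𝓘(ℂ, V) ω
        (fun q : ℂ × Y => (e.symm (q.1, c q.2)).2) (0, y) :=
      ContMDiffAt.comp (0, y) (g := fun x : ℂ × V => (e.symm x).2)
        (f := fun q : ℂ × Y => (q.1, c q.2)) (contDiffAt_snd.comp _ hesymm).contMDiffAt hce
    have hg0 : c.symm (e.symm (0, c y)).2 = y := by rw [hes, c.left_inv hy]
    have hg : ContMDiffAt (𝓘(ℂ, ℂ).prod 𝓘(ℂ, V)) 𝓘(ℂ, V) ω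
        (fun q : ℂ × Y => c.symm (e.symm (q.1, c q.2)).2) (0, y) :=
      ContMDiffAt.comp (0, y) (g := c.symm) (f := fun q : ℂ × Y => (e.symm (q.1, c q.2)).2)
        (by simpa only [hes] using hsymm) h1
    refine ⟨_, hg, ?_⟩
    have hfg : ContinuousAt (fun q : ℂ × Y => f (q.1, c.symm (e.symm (q.1, c q.2)).2)) (0, y) :=
      ContinuousAt.comp (g := f) (by rw [hg0]; exact hf.continuousAt)
        (continuousAt_fst.prodMk hg.continuousAt)
    have hetm : (0, c y) ∈ e.target := by
      have := e.map_source hemem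
      rwa [heu] at this
    filter_upwards [hce.continuousAt.preimage_mem_nhds (e.open_target.mem_nhds hetm),
      continuousAt_snd.preimage_mem_nhds (c.open_source.mem_nhds hy),
      hfg.preimage_mem_nhds (c.open_source.mem_nhds (by rw [hg0, h0]; exact hy))] with q h1 h2 h3
    have h4 := e.right_inv h1
    rw [heH] at h4
    have h5 : (e.symm (q.1, c q.2)).1 = q.1 := congrArg Prod.fst h4
    have h6 : F (e.symm (q.1, c q.2)) = c q.2 := congrArg Prod.snd h4
    refine c.injOn h3 h2 ?_
    rw [← h6]
    simp only [F, h5]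

/-- A holomorphic family of self-maps of a compact manifold which starts at the identity consists
of automorphisms for small parameters. -/
theorem exists_holAt_of_near_identity [T2Space Y] [CompactSpace Y]
    (hf : ∀ y, ContMDiffAt (𝓘(ℂ, ℂ).prod 𝓘(ℂ, V)) 𝓘(ℂ, V) ω f (0, y)) (h0 : ∀ y, f (0, y) = y) :
    ∃ c : ℂ → Equiv.Perm Y, HolAt V c 0 ∧ ∀ᶠ z in 𝓝 0, ∀ y, c z y = f (z, y) := by
  classical
  choose hloc g hg hfg using fun y => exists_local_param_inverse (hf y) h0
  -- Compactness of `Y × Y` reduces injectivity to a local statement: near the diagonal it is the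
  -- inverse function theorem, and off it distinct images stay distinct by continuity.
  have hinj : ∀ᶠ z in 𝓝 (0 : ℂ), ∀ q ∈ (Set.univ : Set (Y × Y)),
      f (z, q.1) = f (z, q.2) → q.1 = q.2 := by
    refine isCompact_univ.eventually_forall_of_forall_eventually
      (P := fun z (q : Y × Y) => f (z, q.1) = f (z, q.2) → q.1 = q.2) ?_
    rintro ⟨y, y'⟩ -
    by_cases h : y = y'
    · subst h; exact hloc y
    · have h1 : ContinuousAt (fun q : ℂ × (Y × Y) => f (q.1, q.2.1)) (0, y, y') :=
        ContinuousAt.comp (g := f) (hf y).continuousAt (by fun_prop)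
      have h2 : ContinuousAt (fun q : ℂ × (Y × Y) => f (q.1, q.2.2)) (0, y, y') :=
        ContinuousAt.comp (g := f) (hf y').continuousAt (by fun_prop)
      filter_upwards [(h1.ne_iff_eventually_ne h2).1 (by simpa [h0] using h)] with q hq hq'
      exact absurd hq' hq
  have hsurj : ∀ᶠ z in 𝓝 (0 : ℂ), ∀ y ∈ (Set.univ : Set Y), ∃ y', f (z, y') = y :=
    isCompact_univ.eventually_forall_of_forall_eventually
      (P := fun z (y : Y) => ∃ y', f (z, y') = y)
      fun y _ => (hfg y).mono fun q hq => ⟨_, hq⟩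
  have hbij : ∀ᶠ z in 𝓝 (0 : ℂ), Function.Bijective fun y => f (z, y) := by
    filter_upwards [hinj, hsurj] with z h1 h2
    exact ⟨fun y y' h => h1 (y, y') trivial h, fun y => h2 y trivial⟩
  -- The value `1` at parameters where the map is not bijective is harmless: none occur near `0`.
  let c : ℂ → Equiv.Perm Y := fun z =>
    if h : Function.Bijective fun y => f (z, y) then Equiv.ofBijective _ h else 1
  have hc : ∀ᶠ z in 𝓝 (0 : ℂ), ∀ y, c z y = f (z, y) := by
    filter_upwards [hbij] with z hz y
    simp [c, hz]
  refine ⟨c, fun y => ⟨?_, ?_⟩, hc⟩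
  · refine (hf y).congr_of_eventuallyEq ?_
    rw [nhds_prod_eq]
    filter_upwards [hc.prod_inl (𝓝 y)] with q hq using hq q.2
  -- Once the maps are bijective, the local right inverse `g y` must be the inverse permutation, so
  -- the inverse is holomorphic.
  · refine (hg y).congr_of_eventuallyEq ?_
    have hc' : ∀ᶠ q : ℂ × Y in 𝓝 (0, y), ∀ y, c q.1 y = f (q.1, y) := by
      rw [nhds_prod_eq]; exact hc.prod_inl (𝓝 y)
    filter_upwards [hc', hfg y] with q h1 h2
    rw [Equiv.Perm.inv_eq_iff_eq, h1, h2]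

end NearIdentity

/-! ### From a chart at the identity to a Lie group -/

section LocalLieGroups

variable {Z : Type*} [NormedAddCommGroup Z] [NormedSpace ℂ Z] {G : Type*} [Group G]

/-- A chart `t ↦ φ t`, `t ∈ B`, of a group around its identity, in which left translations,
multiplication, and inversion (both twisted by conjugations) are holomorphic near the identity. -/
structure IsLocalLieChart (φ : Z → G) (B : Set Z) : Prop where
  isOpen : IsOpen B
  zero_mem : (0 : Z) ∈ B
  map_zero : φ 0 = 1
  injOn : Set.InjOn φ B
  translate : ∀ (a : G), ∀ t ∈ B, ∀ t' ∈ B, a * φ t = φ t' →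
    ∃ τ : Z → Z, ContDiffAt ℂ ω τ t ∧ τ t = t' ∧ ∀ᶠ s in 𝓝 t, a * φ s = φ (τ s)
  -- The conjugations come from multiplying at arbitrary points: `(a * φ s) * (b * φ t) = a * b *
  -- (b⁻¹ * φ s * b * φ t)` and `(a * φ t)⁻¹ = a⁻¹ * (a * (φ t)⁻¹ * a⁻¹)`.
  mul : ∀ b : G, ∃ τ : Z × Z → Z, ContDiffAt ℂ ω τ (0, 0) ∧ τ (0, 0) = 0 ∧
    ∀ᶠ q in 𝓝 (0, 0), b⁻¹ * φ q.1 * b * φ q.2 = φ (τ q)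
  inv : ∀ a : G, ∃ τ : Z → Z, ContDiffAt ℂ ω τ 0 ∧ τ 0 = 0 ∧
    ∀ᶠ t in 𝓝 0, a * (φ t)⁻¹ * a⁻¹ = φ (τ t)

namespace IsLocalLieChart

variable {φ : Z → G} {B : Set Z}

/-- The translate to `a` of the local chart `φ`. -/
noncomputable def chart (h : IsLocalLieChart φ B) (a : G) : PartialEquiv G Z where
  toFun g := Function.invFunOn φ B (a⁻¹ * g)
  invFun t := a * φ t
  source := {g | a⁻¹ * g ∈ φ '' B}
  target := B
  map_source' g hg := Function.invFunOn_mem hg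
  map_target' t ht := ⟨t, ht, by simp⟩
  left_inv' g hg := by rw [Function.invFunOn_eq hg]; simp
  right_inv' t ht := by
    rw [inv_mul_cancel_left]
    exact h.injOn (Function.invFunOn_mem ⟨t, ht, rfl⟩) ht (Function.invFunOn_eq ⟨t, ht, rfl⟩)

variable (h : IsLocalLieChart φ B)

/-- The transition from the chart at `a` to the chart at `b` is left translation by `b⁻¹ * a` read
through `φ`, which `translate` makes analytic. -/
lemma chart_change (a b : G) {t : Z} (ht : t ∈ ((h.chart a).symm.trans (h.chart b)).source) :
    ∃ τ : Z → Z, ContDiffAt ℂ ω τ t ∧ ∀ᶠ s in 𝓝 t,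
      s ∈ ((h.chart a).symm.trans (h.chart b)).source ∧
      (h.chart a).symm.trans (h.chart b) s = τ s := by
  obtain ⟨htB, t', ht', htt'⟩ : t ∈ B ∧ b⁻¹ * (a * φ t) ∈ φ '' B := ht
  obtain ⟨τ, hτ, hτt, hev⟩ := h.translate (b⁻¹ * a) t htB t' ht' (by rw [htt', mul_assoc])
  refine ⟨τ, hτ, ?_⟩
  filter_upwards [hev, h.isOpen.mem_nhds htB,
    hτ.continuousAt.preimage_mem_nhds (h.isOpen.mem_nhds (by rwa [hτt]))] with s hs hsB hsτ
  have hs' : b⁻¹ * (a * φ s) = φ (τ s) := by rw [← hs, mul_assoc]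
  refine ⟨⟨hsB, τ s, hsτ, hs'.symm⟩, ?_⟩
  change Function.invFunOn φ B (b⁻¹ * (a * φ s)) = τ s
  rw [hs']
  exact h.injOn (Function.invFunOn_mem ⟨_, hsτ, rfl⟩) hsτ (Function.invFunOn_eq ⟨_, hsτ, rfl⟩)

/-- The charted space structure on `G` given by the translates of the local chart. -/
noncomputable def core : ChartedSpaceCore Z G where
  atlas := Set.range h.chart
  chartAt := h.chart
  mem_chart_source a := ⟨0, h.zero_mem, by rw [h.map_zero, inv_mul_cancel]⟩
  chart_mem_atlas a := ⟨a, rfl⟩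
  open_source := by
    rintro _ _ ⟨a, rfl⟩ ⟨b, rfl⟩
    rw [isOpen_iff_mem_nhds]
    intro t ht
    obtain ⟨τ, -, hev⟩ := h.chart_change a b ht
    exact hev.mono fun s hs => hs.1
  continuousOn_toFun := by
    rintro _ _ ⟨a, rfl⟩ ⟨b, rfl⟩ t ht
    obtain ⟨τ, hτ, hev⟩ := h.chart_change a b ht
    exact (hτ.continuousAt.congr (hev.mono fun s hs => hs.2.symm)).continuousWithinAt

/-- A group with a local Lie chart is a Lie group. -/
theorem exists_lieGroup (h : IsLocalLieChart φ B) : ∃ (_ : TopologicalSpace G) (_ : ChartedSpace Z G),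
    LieGroup 𝓘(ℂ, Z) ω G ∧ ∀ a : G, (chartAt Z a).source = {g | a⁻¹ * g ∈ φ '' B} ∧
      (chartAt Z a).target = B ∧ ∀ t, (chartAt Z a).symm t = a * φ t := by
  let : TopologicalSpace G := h.core.toTopologicalSpace
  let : ChartedSpace Z G := h.core.toChartedSpace
  have hsymm : ∀ (a : G) (t : Z), (chartAt Z a).symm t = a * φ t := fun a t => rfl
  have hsource : ∀ a : G, (chartAt Z a).source = {g | a⁻¹ * g ∈ φ '' B} := fun a => rfl
  have htarget : ∀ a : G, (chartAt Z a).target = B := fun a => rfl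
  have hmfd : IsManifold 𝓘(ℂ, Z) ω G := by
    refine isManifold_of_contDiffOn _ _ _ ?_
    intro e e' he he' t ht
    obtain ⟨_, ⟨a, rfl⟩, rfl⟩ := Set.mem_iUnion₂.1 he
    obtain ⟨_, ⟨b, rfl⟩, rfl⟩ := Set.mem_iUnion₂.1 he'
    have ht' : t ∈ ((h.chart a).symm.trans (h.chart b)).source := ht.1
    obtain ⟨τ, hτ, hev⟩ := h.chart_change a b ht'
    refine (hτ.congr_of_eventuallyEq ?_).contDiffWithinAt
    exact hev.mono fun s hs => hs.2
  have hzero : ∀ a : G, chartAt Z a a = 0 := by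
    intro a
    have := (chartAt Z a).right_inv (x := 0) h.zero_mem
    rwa [hsymm, h.map_zero, mul_one] at this
  have hchart : ∀ a : G, ContMDiffAt 𝓘(ℂ, Z) 𝓘(ℂ, Z) ω (chartAt Z a) a := fun a =>
    contMDiffOn_chart.contMDiffAt ((chartAt Z a).open_source.mem_nhds (mem_chart_source Z a))
  have hchart' : ∀ a : G, ContMDiffAt 𝓘(ℂ, Z) 𝓘(ℂ, Z) ω (fun t => a * φ t) 0 := fun a =>
    contMDiffOn_chart_symm.contMDiffAt ((chartAt Z a).open_target.mem_nhds h.zero_mem)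
  have hnear : ∀ a : G, ∀ᶠ g in 𝓝 a, a * φ (chartAt Z a g) = g := fun a => by
    filter_upwards [(chartAt Z a).open_source.mem_nhds (mem_chart_source Z a)] with g hg
    exact (chartAt Z a).left_inv hg
  have hmul : ContMDiff (𝓘(ℂ, Z).prod 𝓘(ℂ, Z)) 𝓘(ℂ, Z) ω fun p : G × G => p.1 * p.2 := by
    rintro ⟨a, b⟩
    obtain ⟨τ, hτ, hτ0, hev⟩ := h.mul b
    have h1 : ContMDiffAt (𝓘(ℂ, Z).prod 𝓘(ℂ, Z)) 𝓘(ℂ, Z × Z) ω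
        (fun p : G × G => (chartAt Z a p.1, chartAt Z b p.2)) (a, b) := by
      rw [modelWithCornersSelf_prod, ← chartedSpaceSelf_prod]
      exact ((hchart a).comp (a, b) contMDiffAt_fst).prodMk
        ((hchart b).comp (a, b) contMDiffAt_snd)
    have h2 : ContMDiffAt (𝓘(ℂ, Z).prod 𝓘(ℂ, Z)) 𝓘(ℂ, Z) ω
        (fun p : G × G => τ (chartAt Z a p.1, chartAt Z b p.2)) (a, b) :=
      ContMDiffAt.comp (a, b) (g := τ) (by rw [hzero, hzero]; exact hτ.contMDiffAt) h1
    have h3 : ContMDiffAt (𝓘(ℂ, Z).prod 𝓘(ℂ, Z)) 𝓘(ℂ, Z) ω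
        (fun p : G × G => a * b * φ (τ (chartAt Z a p.1, chartAt Z b p.2))) (a, b) :=
      ContMDiffAt.comp (a, b) (g := fun t => a * b * φ t)
        (by simp only [hzero, hτ0]; exact hchart' (a * b)) h2
    refine h3.congr_of_eventuallyEq ?_
    have h4 : ∀ᶠ p : G × G in 𝓝 (a, b), b⁻¹ * φ (chartAt Z a p.1) * b * φ (chartAt Z b p.2) =
        φ (τ (chartAt Z a p.1, chartAt Z b p.2)) :=
      Filter.Tendsto.eventually (by simpa only [ContinuousAt, hzero] using h1.continuousAt) hev
    filter_upwards [h4, continuousAt_fst.eventually (hnear a), continuousAt_snd.eventually (hnear b)]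
      with p hp hp1 hp2
    rw [← hp]
    conv_lhs => rw [← hp1, ← hp2]
    group
  have hinv : ContMDiff 𝓘(ℂ, Z) 𝓘(ℂ, Z) ω fun g : G => g⁻¹ := by
    intro a
    obtain ⟨τ, hτ, hτ0, hev⟩ := h.inv a
    have h2 : ContMDiffAt 𝓘(ℂ, Z) 𝓘(ℂ, Z) ω (fun g : G => τ (chartAt Z a g)) a :=
      ContMDiffAt.comp a (g := τ) (by rw [hzero]; exact hτ.contMDiffAt) (hchart a)
    have h3 : ContMDiffAt 𝓘(ℂ, Z) 𝓘(ℂ, Z) ω (fun g : G => a⁻¹ * φ (τ (chartAt Z a g))) a :=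
      ContMDiffAt.comp a (g := fun t => a⁻¹ * φ t)
        (by simp only [hzero, hτ0]; exact hchart' a⁻¹) h2
    refine h3.congr_of_eventuallyEq ?_
    have h4 : ∀ᶠ g in 𝓝 a, a * (φ (chartAt Z a g))⁻¹ * a⁻¹ = φ (τ (chartAt Z a g)) :=
      Filter.Tendsto.eventually (by simpa only [ContinuousAt, hzero] using (hchart a).continuousAt)
        hev
    filter_upwards [h4, hnear a] with g hg hg1
    rw [← hg]
    conv_lhs => rw [← hg1]
    group
  exact ⟨_, _, { hmfd with contMDiff_mul := hmul, contMDiff_inv := hinv },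
    fun a => ⟨hsource a, htarget a, hsymm a⟩⟩

end IsLocalLieChart

end LocalLieGroups

/-! ### Countable covers of groups generated by a chart -/

lemma Subgroup.countable_closure {G : Type*} [Group G] {s : Set G} (hs : s.Countable) :
    (Subgroup.closure s : Set G).Countable := by
  have := hs.to_subtype
  have h1 : (Subgroup.closure s : Set G) = Set.range (FreeGroup.lift (Subtype.val : s → G)) := by
    rw [← MonoidHom.coe_range, FreeGroup.range_lift_eq_closure, Subtype.range_coe]
  rw [h1]
  exact Set.countable_range _

section

variable {Z : Type*} [TopologicalSpace Z] [SecondCountableTopology Z] {G : Type*}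
  [Group G] [TopologicalSpace G] [IsTopologicalGroup G]

/-- A topological group generated by a neighbourhood `ψ '' B` of the identity, where `B` is an open
subset of a second countable space, is covered by countably many translates of `ψ '' B`. -/
lemma exists_countable_cover_translates {ψ : Z → G} {B : Set Z} (hB : IsOpen B)
    (hne : B.Nonempty) (hψ : ContinuousOn ψ B) (hopen : IsOpen (ψ '' B))
    (hgen : Subgroup.closure (ψ '' B) = ⊤) :
    ∃ s : Set G, s.Countable ∧ ∀ g : G, ∃ a ∈ s, a⁻¹ * g ∈ ψ '' B := by
  obtain ⟨d, hdc, hd⟩ := TopologicalSpace.exists_countable_dense Z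
  let D := Subgroup.closure (ψ '' (B ∩ d))
  have hDc : (D : Set G).Countable :=
    Subgroup.countable_closure ((hdc.mono Set.inter_subset_right).image ψ)
  -- The closure of `D` is a subgroup, and by continuity of `ψ` it contains the generating set `ψ ''
  -- B`.
  have hDd : Dense (D : Set G) := by
    have h1 : D.topologicalClosure = ⊤ := by
      rw [eq_top_iff, ← hgen, Subgroup.closure_le]
      rintro _ ⟨t, ht, rfl⟩
      have h2 : t ∈ closure (B ∩ d) := hd.open_subset_closure_inter hB ht
      have h3 : ψ t ∈ closure (ψ '' (B ∩ d)) :=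
        mem_closure_image (hψ.continuousAt (hB.mem_nhds ht)) h2
      exact closure_mono Subgroup.subset_closure h3
    rw [dense_iff_closure_eq, ← Subgroup.topologicalClosure_coe, h1, Subgroup.coe_top]
  refine ⟨D, hDc, fun g => ?_⟩
  -- The elements `a` whose translate of `ψ '' B` contains `g` form a nonempty open set, so one of
  -- them lies in the dense subgroup `D`.
  have h4 : IsOpen {a : G | a⁻¹ * g ∈ ψ '' B} := hopen.preimage (by fun_prop)
  obtain ⟨t, ht⟩ := hne
  obtain ⟨a, ha, haD⟩ := hDd.inter_open_nonempty _ h4 ⟨g * (ψ t)⁻¹, t, ht, by group⟩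
  exact ⟨a, haD, ha⟩

end

/-! ### The group generated by a local chart, and its orbits -/

section

variable {Y : Type u} {m : ℕ} {φ : EuclideanSpace ℂ (Fin m) → Equiv.Perm Y}
  {B : Set (EuclideanSpace ℂ (Fin m))}

namespace IsLocalChart

open Classical in
/-- The local chart, with values in the group it generates. -/
noncomputable def lift (φ : EuclideanSpace ℂ (Fin m) → Equiv.Perm Y)
    (B : Set (EuclideanSpace ℂ (Fin m))) (t : EuclideanSpace ℂ (Fin m)) :
    Subgroup.closure (φ '' B) :=
  if ht : t ∈ B then ⟨φ t, Subgroup.subset_closure ⟨t, ht, rfl⟩⟩ else 1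

lemma coe_lift {t : EuclideanSpace ℂ (Fin m)} (ht : t ∈ B) :
    (lift φ B t : Equiv.Perm Y) = φ t := by simp [lift, ht]

lemma closure_range_lift (φ : EuclideanSpace ℂ (Fin m) → Equiv.Perm Y)
    (B : Set (EuclideanSpace ℂ (Fin m))) : Subgroup.closure (lift φ B '' B) = ⊤ := by
  have h1 : lift φ B '' B = Subtype.val ⁻¹' (φ '' B) := by
    ext g
    constructor
    · rintro ⟨t, ht, rfl⟩
      exact ⟨t, ht, (coe_lift ht).symm⟩
    · rintro ⟨t, ht, htg⟩
      exact ⟨t, ht, Subtype.ext (by rw [coe_lift ht, htg])⟩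
  rw [h1]
  exact Subgroup.closure_closure_coe_preimage

end IsLocalChart

end

section

variable {V : Type*} [NormedAddCommGroup V] [NormedSpace ℂ V]
  {Y : Type u} [TopologicalSpace Y] [ChartedSpace V Y] {m : ℕ}
  {φ : EuclideanSpace ℂ (Fin m) → Equiv.Perm Y} {B : Set (EuclideanSpace ℂ (Fin m))}

namespace IsLocalChart

lemma holAt_of_mem_closure (h : IsLocalChart V φ B) {g : Equiv.Perm Y}
    (hg : g ∈ Subgroup.closure (φ '' B)) {W : Type*} [NormedAddCommGroup W] [NormedSpace ℂ W]
    (w : W) : HolAt V (fun _ : W => g) w := by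
  induction hg using Subgroup.closure_induction with
  | mem g hg => obtain ⟨t, ht, rfl⟩ := hg; exact (h.holAt t ht).const w
  | one => exact HolAt.one w
  | mul g g' _ _ h1 h2 => exact h1.mul h2
  | inv g _ h1 => exact h1.inv

/-- Each group law is `factor` applied to a family built from `φ` and fixed group elements by
products and inverses. Shrinking the parameters keeps the values of `τ` in `B`, where `lift` agrees
with `φ`. -/
lemma isLocalLieChart (h : IsLocalChart V φ B) : IsLocalLieChart (lift φ B) B where
  isOpen := h.isOpen
  zero_mem := h.zero_mem
  map_zero := Subtype.ext (by rw [coe_lift h.zero_mem, h.map_zero]; rfl)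
  injOn t ht t' ht' htt' := h.injOn ht ht' (by
    rw [← coe_lift (φ := φ) ht, htt', coe_lift ht'])
  translate a t ht t' ht' heq := by
    obtain ⟨τ, hτ, hτt, hev⟩ := h.factor (Ψ := fun s => (a : Equiv.Perm Y) * φ s) ht'
      ((h.holAt_of_mem_closure a.2 t).mul (h.holAt t ht))
      (by simpa [coe_lift ht, coe_lift ht'] using congrArg Subtype.val heq)
    refine ⟨τ, hτ, hτt, ?_⟩
    filter_upwards [hev, h.isOpen.mem_nhds ht,
      hτ.continuousAt.preimage_mem_nhds (h.isOpen.mem_nhds (by rwa [hτt]))] with s h1 h2 h3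
    exact Subtype.ext (by rw [coe_lift (φ := φ) (B := B) h3, ← h1, Subgroup.coe_mul, coe_lift (φ := φ) (B := B) h2])
  mul b := by
    have h0 := h.holAt 0 h.zero_mem
    obtain ⟨τ, hτ, hτt, hev⟩ := h.factor
      (Ψ := fun q : EuclideanSpace ℂ (Fin m) × EuclideanSpace ℂ (Fin m) =>
        (b : Equiv.Perm Y)⁻¹ * φ q.1 * b * φ q.2) (w := (0, 0)) h.zero_mem
      ((((h.holAt_of_mem_closure b.2 _).inv.mul
        (HolAt.comp_param (τ := Prod.fst) contDiffAt_fst h0)).mul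
        (h.holAt_of_mem_closure b.2 _)).mul (HolAt.comp_param (τ := Prod.snd) contDiffAt_snd h0))
      (by simp [h.map_zero])
    refine ⟨τ, hτ, hτt, ?_⟩
    have hB := h.isOpen.mem_nhds h.zero_mem
    filter_upwards [hev, continuousAt_fst.preimage_mem_nhds hB,
      continuousAt_snd.preimage_mem_nhds hB,
      hτ.continuousAt.preimage_mem_nhds (by rwa [hτt])] with q h1 h2 h3 h4
    refine Subtype.ext ?_
    rw [coe_lift (φ := φ) (B := B) h4, ← h1]
    simp only [Subgroup.coe_mul, Subgroup.coe_inv]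
    rw [coe_lift (φ := φ) (B := B) h2, coe_lift (φ := φ) (B := B) h3]
  inv a := by
    have h0 := h.holAt 0 h.zero_mem
    obtain ⟨τ, hτ, hτt, hev⟩ := h.factor
      (Ψ := fun t => (a : Equiv.Perm Y) * (φ t)⁻¹ * (a : Equiv.Perm Y)⁻¹) h.zero_mem
      (((h.holAt_of_mem_closure a.2 _).mul h0.inv).mul (h.holAt_of_mem_closure a.2 _).inv)
      (by simp [h.map_zero])
    refine ⟨τ, hτ, hτt, ?_⟩
    have hB := h.isOpen.mem_nhds h.zero_mem
    filter_upwards [hev, hB, hτ.continuousAt.preimage_mem_nhds (by rwa [hτt])] with t h1 h2 h4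
    refine Subtype.ext ?_
    rw [coe_lift (φ := φ) (B := B) h4, ← h1]
    simp only [Subgroup.coe_mul, Subgroup.coe_inv]
    rw [coe_lift (φ := φ) (B := B) h2]

/-- The orbit map `t ↦ φ t y` has surjective derivative at `0`, so it is open there. -/
lemma orbit_mem_nhds [CompleteSpace V] [IsManifold 𝓘(ℂ, V) ω Y] (h : IsLocalChart V φ B)
    (hspan : ∀ (y : Y) (u : V), ∃ ξ, vel φ 0 ξ y = u) (y : Y) :
    MulAction.orbit (Subgroup.closure (φ '' B)) y ∈ 𝓝 y := by
  have hφ := h.holAt 0 h.zero_mem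
  have hy : φ 0 y ∈ (chartAt V y).source := by simp [h.map_zero]
  have hd := contDiffAt_chart_comp (hφ.apply y) hy
  have hs := hd.hasStrictFDerivAt (by simp)
  have hrange : (fderiv ℂ (fun t => chartAt V y (φ t y)) 0).range = ⊤ := by
    refine LinearMap.range_eq_top.2 fun u => ?_
    obtain ⟨ξ, hξ⟩ := hspan y u
    exact ⟨ξ, by simpa [vel_apply, h.map_zero] using hξ⟩
  have hmap := hs.map_nhds_eq_of_surj hrange
  simp only [h.map_zero, Equiv.Perm.coe_one, id_eq] at hmap
  have hpre : ∀ᶠ t in 𝓝 (0 : EuclideanSpace ℂ (Fin m)), φ t y ∈ (chartAt V y).source :=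
    (hφ.apply y).continuousAt.preimage_mem_nhds ((chartAt V y).open_source.mem_nhds hy)
  have himg : (fun t => chartAt V y (φ t y)) '' {t | t ∈ B ∧ φ t y ∈ (chartAt V y).source} ∈
      𝓝 (chartAt V y y) := by
    rw [← hmap]
    exact Filter.image_mem_map (Filter.Eventually.and (h.isOpen.mem_nhds h.zero_mem) hpre)
  filter_upwards [((chartAt V y).continuousAt (mem_chart_source V y)).preimage_mem_nhds himg,
    (chartAt V y).open_source.mem_nhds (mem_chart_source V y)] with z hz hzs
  obtain ⟨t, ⟨htB, hts⟩, htz⟩ := hz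
  exact ⟨⟨φ t, Subgroup.subset_closure ⟨t, htB, rfl⟩⟩, (chartAt V y).injOn hts hzs htz⟩

/-- A compact connected complex manifold whose tangent spaces are spanned by the velocities of a
local chart of automorphisms is homogeneous. -/
theorem isComplexHomogeneous [CompleteSpace V] [IsManifold 𝓘(ℂ, V) ω Y] [T2Space Y]
    [ConnectedSpace Y] (h : IsLocalChart V φ B)
    (hspan : ∀ (y : Y) (u : V), ∃ ξ, vel φ 0 ξ y = u) : IsComplexHomogeneous V Y := by
  obtain ⟨_, _, hLie, hchart⟩ := h.isLocalLieChart.exists_lieGroup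
  have : IsManifold 𝓘(ℂ, EuclideanSpace ℂ (Fin m)) ω (Subgroup.closure (φ '' B)) :=
    hLie.toIsManifold
  have hsmul : ContMDiffSMul 𝓘(ℂ, EuclideanSpace ℂ (Fin m)) 𝓘(ℂ, V) ω
      (Subgroup.closure (φ '' B)) Y := by
    refine ⟨?_⟩
    rintro ⟨a, y⟩
    have ha : ContMDiffAt 𝓘(ℂ, EuclideanSpace ℂ (Fin m)) 𝓘(ℂ, EuclideanSpace ℂ (Fin m)) ω
        (chartAt (EuclideanSpace ℂ (Fin m)) a) a :=
      contMDiffOn_chart.contMDiffAt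
        ((chartAt _ a).open_source.mem_nhds (mem_chart_source _ a))
    have hsrc : ∀ᶠ g in 𝓝 a, g ∈ (chartAt (EuclideanSpace ℂ (Fin m)) a).source :=
      (chartAt _ a).open_source.mem_nhds (mem_chart_source _ a)
    have h0 : chartAt (EuclideanSpace ℂ (Fin m)) a a = 0 := by
      have h1 := (chartAt (EuclideanSpace ℂ (Fin m)) a).right_inv (x := 0)
        (by rw [(hchart a).2.1]; exact h.zero_mem)
      rwa [(hchart a).2.2, h.isLocalLieChart.map_zero, mul_one] at h1
    have hF : HolAt V (fun t => (a : Equiv.Perm Y) * φ t) 0 :=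
      (h.holAt_of_mem_closure a.2 0).mul (h.holAt 0 h.zero_mem)
    have h1 : ContMDiffAt (𝓘(ℂ, EuclideanSpace ℂ (Fin m)).prod 𝓘(ℂ, V))
        (𝓘(ℂ, EuclideanSpace ℂ (Fin m)).prod 𝓘(ℂ, V)) ω
        (fun p : Subgroup.closure (φ '' B) × Y =>
          (chartAt (EuclideanSpace ℂ (Fin m)) a p.1, p.2)) (a, y) :=
      (ha.comp (a, y) contMDiffAt_fst).prodMk contMDiffAt_snd
    refine (ContMDiffAt.comp (a, y) (g := fun q : EuclideanSpace ℂ (Fin m) × Y =>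
      ((a : Equiv.Perm Y) * φ q.1) q.2) (by rw [h0]; exact (hF y).1) h1).congr_of_eventuallyEq ?_
    filter_upwards [continuousAt_fst.eventually hsrc] with p hp
    have hB : chartAt (EuclideanSpace ℂ (Fin m)) a p.1 ∈ B := by
      have := (chartAt (EuclideanSpace ℂ (Fin m)) a).map_source hp
      rwa [(hchart a).2.1] at this
    have h2 := (chartAt (EuclideanSpace ℂ (Fin m)) a).left_inv hp
    rw [(hchart a).2.2] at h2
    have h3 := congrArg Subtype.val h2
    rw [Subgroup.coe_mul, coe_lift hB] at h3
    simp only [Function.comp_apply, h3]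
    rfl
  have hcont : ContinuousSMul (Subgroup.closure (φ '' B)) Y :=
    ContMDiffSMul.continuousSMul (I := 𝓘(ℂ, EuclideanSpace ℂ (Fin m))) (I' := 𝓘(ℂ, V)) ω
  -- Group elements are permutations of the Hausdorff space `Y`, so the continuous maps `g ↦ g • y`
  -- separate them.
  have hT2 : T2Space (Subgroup.closure (φ '' B)) := by
    refine ⟨fun g g' hne => ?_⟩
    obtain ⟨y, hy⟩ : ∃ y : Y, g • y ≠ g' • y := by
      by_contra! hcon
      exact hne (Subtype.ext (Equiv.ext hcon))
    exact separated_by_continuous (f := fun g : Subgroup.closure (φ '' B) => g • y)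
      (by fun_prop) hy
  have hgrp : IsTopologicalGroup (Subgroup.closure (φ '' B)) :=
    topologicalGroup_of_lieGroup 𝓘(ℂ, EuclideanSpace ℂ (Fin m)) ω
  have hsc : SecondCountableTopology (Subgroup.closure (φ '' B)) := by
    have hψ : lift φ B = (chartAt (EuclideanSpace ℂ (Fin m)) (1 : Subgroup.closure (φ '' B))).symm :=
      funext fun t => by rw [(hchart 1).2.2, one_mul]
    have hsrc : (chartAt (EuclideanSpace ℂ (Fin m)) (1 : Subgroup.closure (φ '' B))).source =
        lift φ B '' B := by rw [(hchart 1).1]; ext g; simp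
    obtain ⟨s, hs, hcover⟩ := exists_countable_cover_translates (ψ := lift φ B) h.isOpen
      ⟨0, h.zero_mem⟩ (by
        rw [hψ]
        exact (chartAt _ _).continuousOn_symm.mono (hchart 1).2.1.ge)
      (by rw [← hsrc]; exact (chartAt _ _).open_source) (closure_range_lift φ B)
    refine ChartedSpace.secondCountable_of_countable_cover (EuclideanSpace ℂ (Fin m)) (s := s)
      (Set.eq_univ_of_forall fun g => ?_) hs
    obtain ⟨a, ha, hag⟩ := hcover g
    exact Set.mem_iUnion₂.2 ⟨a, ha, by rw [(hchart a).1]; exact hag⟩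
  have htrans : MulAction.IsPretransitive (Subgroup.closure (φ '' B)) Y := by
    have hopen : ∀ y : Y, IsOpen (MulAction.orbit (Subgroup.closure (φ '' B)) y) := fun y =>
      isOpen_iff_mem_nhds.2 fun z hz => by
        rw [← MulAction.orbit_eq_iff.2 hz]; exact h.orbit_mem_nhds hspan z
    refine ⟨fun y z => ?_⟩
    -- The complement of an orbit is a union of orbits, hence open as well; connectedness then
    -- leaves one orbit.
    have hclosed : IsClosed (MulAction.orbit (Subgroup.closure (φ '' B)) y) := by
      rw [← isOpen_compl_iff, isOpen_iff_mem_nhds]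
      intro z hz
      refine Filter.mem_of_superset (h.orbit_mem_nhds hspan z) fun w hw hwy => hz ?_
      rw [← MulAction.orbit_eq_iff] at hw hwy ⊢
      rw [← hw, hwy]
    have huniv := IsClopen.eq_univ ⟨hclosed, hopen y⟩ (MulAction.nonempty_orbit y)
    have hz : z ∈ MulAction.orbit (Subgroup.closure (φ '' B)) y := by rw [huniv]; trivial
    exact hz
  exact ⟨m, Subgroup.closure (φ '' B), _, _, _, _, hT2, hsc, hLie, hsmul, htrans⟩

end IsLocalChart

end

/-! ### Velocities obtained from the spray -/

section Sprays

variable {V : Type*} [NormedAddCommGroup V] [NormedSpace ℂ V]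
  {Y : Type u} [TopologicalSpace Y] [ChartedSpace V Y]
  {F : Type*} [NormedAddCommGroup F] [NormedSpace ℂ F]
  {E : Y → Type*} [TopologicalSpace (Bundle.TotalSpace F E)] [∀ y, TopologicalSpace (E y)]
  [FiberBundle F E]

lemma hasMFDerivAt_proj (p : Bundle.TotalSpace F E) :
    HasMFDerivAt (𝓘(ℂ, V).prod 𝓘(ℂ, F)) 𝓘(ℂ, V)
      (Bundle.TotalSpace.proj : Bundle.TotalSpace F E → Y) p (ContinuousLinearMap.fst ℂ V F) := by
  refine ⟨(FiberBundle.continuous_proj F E).continuousAt, ?_⟩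
  refine HasFDerivAt.hasFDerivWithinAt ?_
  refine (hasFDerivAt_fst (𝕜 := ℂ)).congr_of_eventuallyEq ?_
  have ht : (extChartAt (𝓘(ℂ, V).prod 𝓘(ℂ, F)) p).target ∈
      𝓝 (extChartAt (𝓘(ℂ, V).prod 𝓘(ℂ, F)) p p) := extChartAt_target_mem_nhds p
  filter_upwards [ht] with q hq
  rw [FiberBundle.extChartAt_target] at hq
  simp only [writtenInExtChartAt, FiberBundle.extChartAt, Function.comp_apply]
  change extChartAt 𝓘(ℂ, V) p.proj ((trivializationAt F E p.proj).toOpenPartialHomeomorph.symm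
    ((extChartAt 𝓘(ℂ, V) p.proj).symm q.1, q.2)).proj = q.1
  rw [(trivializationAt F E p.proj).proj_symm_apply' hq.1.2]
  exact (extChartAt 𝓘(ℂ, V) p.proj).right_inv hq.1.1

variable [∀ y, AddCommGroup (E y)] [∀ y, Module ℂ (E y)]

/-- Global sections form a `ℂ`-module and evaluation is linear, so their values at `y` are already a
subspace and the span adds nothing. -/
lemma exists_section_apply_eq [VectorBundle ℂ F E] (hE : IsGloballyGenerated V F E) {y : Y}
    (e : E y) : ∃ σ : Cₛ^ω⟮𝓘(ℂ, V); F, E⟯, σ y = e := by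
  have he : e ∈ Submodule.span ℂ (Set.range fun σ : Cₛ^ω⟮𝓘(ℂ, V); F, E⟯ => σ y) := by
    rw [hE y]; trivial
  induction he using Submodule.span_induction with
  | mem e he => exact he
  | zero => exact ⟨0, rfl⟩
  | add _ _ _ _ h1 h2 =>
    obtain ⟨⟨σ, rfl⟩, τ, rfl⟩ := And.intro h1 h2
    exact ⟨σ + τ, rfl⟩
  | smul c _ _ h1 =>
    obtain ⟨σ, rfl⟩ := h1
    exact ⟨c • σ, rfl⟩

variable [VectorBundle ℂ F E]

lemma trivializationAt_smul_snd {y z : Y} (hz : z ∈ (trivializationAt F E y).baseSet) (c : ℂ)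
    (e : E z) : (trivializationAt F E y ⟨z, c • e⟩).2 = c • (trivializationAt F E y ⟨z, e⟩).2 :=
  ((trivializationAt F E y).linear ℂ hz).map_smul c e

lemma contMDiffAt_smul_section (σ : Cₛ^ω⟮𝓘(ℂ, V); F, E⟯) (c : ℂ) (y : Y) :
    ContMDiffAt (𝓘(ℂ, ℂ).prod 𝓘(ℂ, V)) (𝓘(ℂ, V).prod 𝓘(ℂ, F)) ω
      (fun q : ℂ × Y => (⟨q.2, q.1 • σ q.2⟩ : Bundle.TotalSpace F E)) (c, y) := by
  rw [Bundle.contMDiffAt_totalSpace]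
  refine ⟨contMDiffAt_snd, ?_⟩
  have h1 : ContMDiffAt 𝓘(ℂ, V) 𝓘(ℂ, F) ω
      (fun z => (trivializationAt F E y ⟨z, σ z⟩).2) y :=
    (Bundle.contMDiffAt_section y).1 (σ.contMDiff y)
  have h2 : ContMDiffAt (𝓘(ℂ, ℂ).prod 𝓘(ℂ, V)) 𝓘(ℂ, F) ω
      (fun q : ℂ × Y => q.1 • (trivializationAt F E y ⟨q.2, σ q.2⟩).2) (c, y) :=
    contMDiffAt_fst.smul (ContMDiffAt.comp (c, y)
      (g := fun z => (trivializationAt F E y ⟨z, σ z⟩).2) (f := Prod.snd) h1 contMDiffAt_snd)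
  refine h2.congr_of_eventuallyEq ?_
  filter_upwards [continuousAt_snd.preimage_mem_nhds
    ((trivializationAt F E y).open_baseSet.mem_nhds
      (FiberBundle.mem_baseSet_trivializationAt' y))] with q hq
  exact trivializationAt_smul_snd hq q.1 (σ q.2)

lemma hasMFDerivAt_smul_fiber {y : Y} (e : E y) (f : F)
    (hf : (trivializationAt F E y ⟨y, e⟩).2 = f) :
    HasMFDerivAt 𝓘(ℂ, ℂ) (𝓘(ℂ, V).prod 𝓘(ℂ, F))
      (fun z : ℂ => (⟨y, z • e⟩ : Bundle.TotalSpace F E)) 0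
      ((ContinuousLinearMap.id ℂ ℂ).smulRight ((0, f) : V × F)) := by
  have hy := FiberBundle.mem_baseSet_trivializationAt' (F := F) (E := E) y
  have hsmul : ∀ z : ℂ, (trivializationAt F E y ⟨y, z • e⟩).2 = z • f := fun z => by
    rw [trivializationAt_smul_snd hy, hf]
  have hc : ContMDiffAt 𝓘(ℂ, ℂ) (𝓘(ℂ, V).prod 𝓘(ℂ, F)) ω
      (fun z : ℂ => (⟨y, z • e⟩ : Bundle.TotalSpace F E)) 0 := by
    rw [Bundle.contMDiffAt_totalSpace]
    refine ⟨contMDiffAt_const, ?_⟩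
    simp only [hsmul]
    exact (contDiffAt_id.smul contDiffAt_const).contMDiffAt
  refine ⟨hc.continuousAt, ?_⟩
  have hw : writtenInExtChartAt 𝓘(ℂ, ℂ) (𝓘(ℂ, V).prod 𝓘(ℂ, F)) (0 : ℂ)
      (fun z : ℂ => (⟨y, z • e⟩ : Bundle.TotalSpace F E)) =
      fun z : ℂ => ((extChartAt 𝓘(ℂ, V) y y, z • f) : V × F) := by
    ext1 z
    simp only [writtenInExtChartAt, FiberBundle.extChartAt, Function.comp_apply,
      PartialEquiv.coe_trans, PartialEquiv.prod_coe, PartialEquiv.refl_coe, id_eq,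
      extChartAt_model_space_eq_id, PartialEquiv.refl_symm]
    refine Prod.ext ?_ (hsmul z)
    exact congrArg (extChartAt 𝓘(ℂ, V) y) ((trivializationAt F E y).coe_fst' hy)
  rw [hw]
  have hd : HasFDerivAt (fun z : ℂ => ((extChartAt 𝓘(ℂ, V) y y, z • f) : V × F))
      ((0 : ℂ →L[ℂ] V).prod ((ContinuousLinearMap.id ℂ ℂ).smulRight f)) 0 :=
    (hasFDerivAt_const _ _).prodMk ((hasFDerivAt_id (𝕜 := ℂ) (0 : ℂ)).smul_const f)
  have he : (ContinuousLinearMap.id ℂ ℂ).smulRight ((0, f) : V × F) =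
      (0 : ℂ →L[ℂ] V).prod ((ContinuousLinearMap.id ℂ ℂ).smulRight f) := by
    ext <;> simp
  exact (he ▸ hd).hasFDerivWithinAt

/-- In the bundle chart the projection is the first coordinate, so a vertical vector is `(0, f)`; it
is the velocity of the line `z ↦ z • e` in the fibre, with `e` the vector whose trivialization is
`f`. -/
lemma exists_hasMFDerivAt_smul_of_mem_vertical {y : Y}
    (w : TangentSpace (𝓘(ℂ, V).prod 𝓘(ℂ, F)) (Bundle.zeroSection F E y))
    (hw : w ∈ verticalTangentZero (V := V) F E y) : ∃ e : E y,
      HasMFDerivAt 𝓘(ℂ, ℂ) (𝓘(ℂ, V).prod 𝓘(ℂ, F))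
        (fun z : ℂ => (⟨y, z • e⟩ : Bundle.TotalSpace F E)) 0
        ((ContinuousLinearMap.id ℂ ℂ).smulRight (show V × F from w)) := by
  have hw1 : (show V × F from w).1 = 0 := by
    have h1 : mfderiv (𝓘(ℂ, V).prod 𝓘(ℂ, F)) 𝓘(ℂ, V)
      (Bundle.TotalSpace.proj : Bundle.TotalSpace F E → Y) (Bundle.zeroSection F E y) w = 0 := hw
    rw [(hasMFDerivAt_proj (V := V) (Bundle.zeroSection F E y)).mfderiv] at h1
    exact h1
  have hy := FiberBundle.mem_baseSet_trivializationAt' (F := F) (E := E) y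
  refine ⟨(trivializationAt F E y).symm y (show V × F from w).2, ?_⟩
  have h2 := hasMFDerivAt_smul_fiber (V := V)
    ((trivializationAt F E y).symm y (show V × F from w).2) (show V × F from w).2
    (by rw [(trivializationAt F E y).apply_mk_symm hy])
  have h3 : (show V × F from w) = (0, (show V × F from w).2) := Prod.ext hw1 rfl
  rw [h3]
  exact h2

/-- The derivative at the origins of the fibres of a dominating spray along a global section is the
velocity of a holomorphic family of automorphisms; these velocities span the tangent spaces. -/
theorem IsLocalDominatingSpray.exists_autVF [IsManifold 𝓘(ℂ, V) ω Y]
    [CompleteSpace V] [T2Space Y] [CompactSpace Y]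
    {U : Set (Bundle.TotalSpace F E)} {s : Bundle.TotalSpace F E → Y}
    (hs : IsLocalDominatingSpray (V := V) F E U s) (hE : IsGloballyGenerated V F E)
    (y : Y) (u : V) : ∃ v ∈ autVF V Y, v y = u := by
  have hu : (show TangentSpace 𝓘(ℂ, V) (s (Bundle.zeroSection F E y)) from u) ∈
      (verticalTangentZero (V := V) F E y).map
        (mfderiv (𝓘(ℂ, V).prod 𝓘(ℂ, F)) 𝓘(ℂ, V) s (Bundle.zeroSection F E y)).toLinearMap := by
    rw [hs.dominating y]; trivial
  obtain ⟨w, hw, hwu⟩ := hu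
  obtain ⟨e, he⟩ := exists_hasMFDerivAt_smul_of_mem_vertical w hw
  obtain ⟨σ, rfl⟩ := exists_section_apply_eq hE e
  have hzero : ∀ y : Y, (⟨y, (0 : ℂ) • σ y⟩ : Bundle.TotalSpace F E) = Bundle.zeroSection F E y :=
    fun y => by rw [zero_smul]; rfl
  have hsat : ∀ y : Y, ContMDiffAt (𝓘(ℂ, V).prod 𝓘(ℂ, F)) 𝓘(ℂ, V) ω s (Bundle.zeroSection F E y) :=
    fun y => hs.holomorphicOn.contMDiffAt (hs.isOpen.mem_nhds (hs.zeroSection_mem y))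
  -- The section `σ` was chosen through `e`, the fibre vector that the differential of `s` sends to
  -- `u`, so the velocity of `f` at `y` is `u`.
  let f : ℂ × Y → Y := fun q => s ⟨q.2, q.1 • σ q.2⟩
  have hf : ∀ y, ContMDiffAt (𝓘(ℂ, ℂ).prod 𝓘(ℂ, V)) 𝓘(ℂ, V) ω f (0, y) := fun y =>
    ContMDiffAt.comp (0, y) (g := s)
      (f := fun q : ℂ × Y => (⟨q.2, q.1 • σ q.2⟩ : Bundle.TotalSpace F E))
      (by rw [hzero]; exact hsat y) (contMDiffAt_smul_section σ 0 y)
  have hf0 : ∀ y, f (0, y) = y := fun y => by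
    simp only [f]; rw [hzero]; exact hs.apply_zeroSection y
  obtain ⟨c, hc, hcf⟩ := exists_holAt_of_near_identity hf hf0
  have hc1 : c 0 = 1 := Equiv.ext fun y => (hcf.self_of_nhds y).trans (hf0 y)
  refine ⟨vel c 0 1, vel_mem_autVF hc 1, ?_⟩
  set D : V × F →L[ℂ] V :=
    mfderiv (𝓘(ℂ, V).prod 𝓘(ℂ, F)) 𝓘(ℂ, V) s (Bundle.zeroSection F E y)
  -- The base point is kept variable because `0 • σ y` is only propositionally zero, while the type
  -- of the derivative depends on that point.
  have hs' : ∀ p, p = Bundle.zeroSection F E y →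
      HasMFDerivAt (𝓘(ℂ, V).prod 𝓘(ℂ, F)) 𝓘(ℂ, V) s p D := by
    rintro _ rfl
    exact ((hsat y).mdifferentiableAt (by simp)).hasMFDerivAt
  have h1 := ((hs' _ (hzero y)).comp 0 he).2
  have h2 : HasFDerivAt (fun z : ℂ => chartAt V y (f (z, y)))
      (D.comp ((ContinuousLinearMap.id ℂ ℂ).smulRight (show V × F from w))) 0 := by
    have h3 : s (⟨y, (0 : ℂ) • σ y⟩ : Bundle.TotalSpace F E) = y := hf0 y
    simp only [writtenInExtChartAt, Function.comp_def, extChartAt_model_space_eq_id] at h1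
    simp only [h3] at h1
    rw [modelWithCornersSelf_coe, Set.range_id] at h1
    rw [← hasFDerivWithinAt_univ]
    exact h1
  have h4 : HasFDerivAt (fun z : ℂ => chartAt V y (c z y)) _ 0 :=
    h2.congr_of_eventuallyEq (hcf.mono fun z hz => congrArg (chartAt V y) (hz y))
  rw [vel_apply, hc1]
  simp only [inv_one, Equiv.Perm.coe_one, id_eq]
  rw [h4.fderiv]
  have h5 : D (show V × F from w) = u := hwu
  rw [ContinuousLinearMap.comp_apply, ContinuousLinearMap.smulRight_apply,
    ContinuousLinearMap.id_apply, one_smul, h5]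

end Sprays

theorem mainTheorem2
    {V : Type*} [NormedAddCommGroup V] [NormedSpace ℂ V] [FiniteDimensional ℂ V]
    {Y : Type*} [TopologicalSpace Y] [ChartedSpace V Y] [IsManifold 𝓘(ℂ, V) ω Y]
    [T2Space Y] [CompactSpace Y] [ConnectedSpace Y]
    {F : Type*} [NormedAddCommGroup F] [NormedSpace ℂ F] [FiniteDimensional ℂ F]
    {E : Y → Type*} [TopologicalSpace (Bundle.TotalSpace F E)] [∀ y, TopologicalSpace (E y)]
    [∀ y, AddCommGroup (E y)] [∀ y, Module ℂ (E y)] [FiberBundle F E] [VectorBundle ℂ F E]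
    [ContMDiffVectorBundle ω F E 𝓘(ℂ, V)]
    (U : Set (Bundle.TotalSpace F E)) (s : Bundle.TotalSpace F E → Y)
    (hs : IsLocalDominatingSpray (V := V) F E U s)
    (hE : IsGloballyGenerated V F E) :
    IsComplexHomogeneous V Y := by
  have : CompleteSpace V := FiniteDimensional.complete ℂ V
  obtain ⟨m, φ, B, h, hvel⟩ := exists_isLocalChart V Y
  refine h.isComplexHomogeneous fun y u => ?_
  obtain ⟨v, hv, rfl⟩ := hs.exists_autVF hE y u
  obtain ⟨ξ, rfl⟩ := hvel v hv
  exact ⟨ξ, rfl⟩
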